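/- Let $R$ be a commutative artinian ring and $A$ an Artin $R$-algebra, i.e. an $R$-algebra finitely generated as an $R$-module; let $A\text{-mod}$ be the category of finitely generated left $A$-modules. Let $F$ be an additive subbifunctor of $\mathrm{Ext}^1_A(-,-)$ on $A\text{-mod}$. A short exact sequence $0\to X\to Y\to Z\to 0$ is $F$-exact if its class lies in $F(Z,X)$, and $P$ is $F$-projective if $\mathrm{Hom}_A(P,-)$ is exact on $F$-exact sequences. Assume that $F$ has enough projectives: for every $M$ in $A\text{-mod}$ there is an $F$-exact sequence $0\to K\to P\to M\to 0$ with $P$ $F$-projective. Splicing such sequences gives $F$-projective resolutions $P_\bullet\to M$, and $\mathrm{Ext}^n_F(M,-)=H^n(\mathrm{Hom}_A(P_\bullet,-))$, a functor from $A\text{-mod}$ to abelian groups. Let $K_F(A)$ be the abelian group generated by the isomorphism classes $[M]$ of modules in $A\text{-mod}$ modulo the relations $[N]=[X]+[Y]$ if $N\cong X\oplus Y$, and $[P]=0$ if $P$ is $F$-projective. Let $\Omega_F:K_F(A)\to K_F(A)$ be the homomorphism with $\Omega_F[M]=[K]$ for every sequence $0\to K\to P\to M\to 0$ as above. For $M$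 in $A\text{-mod}$ let $\langle M\rangle\subseteq K_F(A)$ be the subgroup generated by the classes of the indecomposable non-$F$-projective direct summands of $M$, and let $\phi\text{-}\dim_F(M)$ be the least $k\in\mathbb N$ such that $\Omega_F$ restricts to an isomorphism $\Omega_F^m\langle M\rangle\to\Omega_F^{m+1}\langle M\rangle$ for all $m\ge k$. For a positive integer $d$, a relative $d$-Division of $M$ is a pair $(X,Y)$ of modules in $\mathrm{add}(M)$ (direct summands of finite direct sums of copies of $M$) such that (a) $\mathrm{add}(X)\cap\mathrm{add}(Y)=0$; (b) $\mathrm{Ext}^d_F(X,-)\not\cong\mathrm{Ext}^d_F(Y,-)$; (c) $\mathrm{Ext}^{d+1}_F(X,-)\cong\mathrm{Ext}^{d+1}_F(Y,-)$. Theorem 4.8. For every $M$ in $A\text{-mod}$, a number $k$ as in the definition of $\phi\text{-}\dim_F(M)$ exists, and $$\phi\text{-}\dim_F(M)=\max\bigl(\{d : \text{there is a relative } d\text{-Division of } M\}\cup\{0\}\bigr);$$ in particular, this maximum exists. -/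

import Mathlib

open CategoryTheory CategoryTheory.Limits CategoryTheory.Abelian

universe w v u

namespace RelativeHomology

/-- An additive subbifunctor `F` of `Ext¹(-,-)` on an abelian category: a subgroup
`F(Z, X)` of `Ext¹(Z, X)` for all `Z`, `X`, stable under pullback along morphisms `Z' ⟶ Z`
and under pushout along morphisms `X ⟶ X'`. -/
structure AdditiveSubbifunctor (C : Type u) [Category.{v} C] [Abelian C] [HasExt.{w} C] where
  obj (Z X : C) : AddSubgroup (Ext.{w} Z X 1)
  pullback_mem {Z' Z X : C} (f : Z' ⟶ Z) {e : Ext.{w} Z X 1} (he : e ∈ obj Z X) :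
    (Ext.mk₀ f).comp e (zero_add 1) ∈ obj Z' X
  pushout_mem {Z X X' : C} {e : Ext.{w} Z X 1} (he : e ∈ obj Z X) (f : X ⟶ X') :
    e.comp (Ext.mk₀ f) (add_zero 1) ∈ obj Z X'

noncomputable section

namespace AdditiveSubbifunctor

variable {C : Type u} [Category.{v} C] [Abelian C] [HasExt.{w} C]
  (F : AdditiveSubbifunctor.{w} C)

/-- `0 ⟶ X ⟶ Y ⟶ Z ⟶ 0` is `F`-exact: it is short exact and its class lies in `F(Z, X)`. -/
def FExact (S : ShortComplex C) : Prop :=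
  ∃ h : S.ShortExact, h.extClass ∈ F.obj S.X₃ S.X₁

/-- `P` is `F`-projective: `Hom(P, -)` is exact on `F`-exact sequences. (Since `Hom(P, -)` is
always left exact, this means that it carries `F`-epimorphisms to surjections.) -/
def FProjective (P : C) : Prop :=
  ∀ S : ShortComplex C, F.FExact S → ∀ f : P ⟶ S.X₃, ∃ g : P ⟶ S.X₂, g ≫ S.g = f

/-- An `F`-exact sequence `0 ⟶ K ⟶ P ⟶ M ⟶ 0` with `P` an `F`-projective object. -/
structure Presentation (M : C) where
  K : C
  P : C
  ι : K ⟶ P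
  π : P ⟶ M
  w : ι ≫ π = 0
  exact : F.FExact (ShortComplex.mk ι π w)
  proj : F.FProjective P

/-- `F` has enough projectives: every object `M` is the end of an `F`-exact sequence
`0 ⟶ K ⟶ P ⟶ M ⟶ 0` with `P` an `F`-projective object. -/
def EnoughProjectives : Prop := ∀ M : C, Nonempty (F.Presentation M)

/-! ### Relative syzygies and relative Ext -/

section Ext

variable {F} (hF : F.EnoughProjectives)

/-- A chosen `F`-exact sequence `0 ⟶ Ω_F M ⟶ P ⟶ M ⟶ 0` with `P` an `F`-projective object. -/
def EnoughProjectives.presentation (M : C) : F.Presentation M := Classical.choice (hF M)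

/-- The iterated relative syzygies `Ω_F^n M` for the chosen sequences. -/
def EnoughProjectives.syzygy (M : C) : ℕ → C
  | 0 => M
  | n + 1 => (hF.presentation (EnoughProjectives.syzygy M n)).K

/-- The terms `P_n` of the `F`-projective resolution `⋯ ⟶ P₁ ⟶ P₀ ⟶ M ⟶ 0` spliced together
from the `F`-exact sequences `0 ⟶ Ω_F^{n+1} M ⟶ P_n ⟶ Ω_F^n M ⟶ 0`. -/
def EnoughProjectives.resX (M : C) (n : ℕ) : C := (hF.presentation (hF.syzygy M n)).P

/-- The differential `P_{n+1} ⟶ Ω_F^{n+1} M ⟶ P_n` of the `F`-projective resolution. -/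
def EnoughProjectives.resD (M : C) (n : ℕ) : hF.resX M (n + 1) ⟶ hF.resX M n :=
  (hF.presentation (hF.syzygy M (n + 1))).π ≫ (hF.presentation (hF.syzygy M n)).ι

lemma EnoughProjectives.resD_comp (M : C) (n : ℕ) :
    hF.resD M (n + 1) ≫ hF.resD M n = 0 := by
  have aux : ∀ {V W X Y Z : C} (f : V ⟶ W) (g : W ⟶ X) (h : X ⟶ Y) (k : Y ⟶ Z),
      g ≫ h = 0 → (f ≫ g) ≫ h ≫ k = 0 := fun f g h k hgh => by
    rw [Category.assoc, reassoc_of% hgh, zero_comp, comp_zero]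
  exact aux _ _ _ _ (hF.presentation (hF.syzygy M (n + 1))).w

/-- The `n`-cocycles of the complex `Hom(P_•, Y)`. -/
def EnoughProjectives.cocycles (M : C) (n : ℕ) (Y : C) : AddSubgroup (hF.resX M n ⟶ Y) :=
  (Preadditive.leftComp Y (hF.resD M n)).ker

/-- The `n`-coboundaries of the complex `Hom(P_•, Y)`. -/
def EnoughProjectives.coboundaries (M : C) :
    (n : ℕ) → (Y : C) → AddSubgroup (hF.resX M n ⟶ Y)
  | 0, _ => ⊥
  | n + 1, Y => (Preadditive.leftComp Y (hF.resD M n)).range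

lemma EnoughProjectives.coboundaries_le (M : C) (n : ℕ) (Y : C) :
    hF.coboundaries M n Y ≤ hF.cocycles M n Y := by
  cases n with
  | zero => exact bot_le
  | succ n =>
    rintro _ ⟨f, rfl⟩
    change hF.resD M (n + 1) ≫ hF.resD M n ≫ f = 0
    rw [← Category.assoc, hF.resD_comp, zero_comp]

/-- The group `Ext_F^n(M, Y)`: the `n`-th cohomology group of the complex `Hom(P_•, Y)`, where
`P_•` is an `F`-projective resolution of `M`. -/
abbrev EnoughProjectives.ExtGroup (M : C) (n : ℕ) (Y : C) : Type v :=
  hF.cocycles M n Y ⧸ (hF.coboundaries M n Y).addSubgroupOf (hF.cocycles M n Y)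

/-- The map of cocycles induced by `g : Y ⟶ Y'`. -/
def EnoughProjectives.cocyclesMap (M : C) (n : ℕ) {Y Y' : C} (g : Y ⟶ Y') :
    hF.cocycles M n Y →+ hF.cocycles M n Y' :=
  ((Preadditive.rightComp (hF.resX M n) g).comp (hF.cocycles M n Y).subtype).codRestrict
    (hF.cocycles M n Y') (fun f => by
      have h : hF.resD M n ≫ f.1 = 0 := f.2
      change hF.resD M n ≫ f.1 ≫ g = 0
      rw [← Category.assoc, h, zero_comp])

lemma EnoughProjectives.cocyclesMap_mem (M : C) (n : ℕ) {Y Y' : C} (g : Y ⟶ Y') :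
    (hF.coboundaries M n Y).addSubgroupOf (hF.cocycles M n Y) ≤
      ((hF.coboundaries M n Y').addSubgroupOf (hF.cocycles M n Y')).comap
        (hF.cocyclesMap M n g) := by
  intro f hf
  change f.1 ∈ hF.coboundaries M n Y at hf
  change f.1 ≫ g ∈ hF.coboundaries M n Y'
  cases n with
  | zero =>
    have h0 : f.1 = 0 := hf
    change f.1 ≫ g = 0
    rw [h0, zero_comp]
  | succ n =>
    obtain ⟨a, ha⟩ := hf
    change hF.resD M n ≫ a = f.1 at ha
    refine ⟨a ≫ g, ?_⟩
    change hF.resD M n ≫ a ≫ g = f.1 ≫ g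
    rw [← ha, Category.assoc]

/-- The functor `Ext_F^n(M, -)` with values in abelian groups. -/
def EnoughProjectives.extFunctor (M : C) (n : ℕ) : C ⥤ AddCommGrpCat.{v} where
  obj Y := AddCommGrpCat.of (hF.ExtGroup M n Y)
  map g := AddCommGrpCat.ofHom (QuotientAddGroup.map _ _ _ (hF.cocyclesMap_mem M n g))
  map_id Y := by
    ext x
    change QuotientAddGroup.mk (hF.cocyclesMap M n (𝟙 Y) x) = QuotientAddGroup.mk x
    congr 1
    exact Subtype.ext (Category.comp_id x.1)
  map_comp {Y Y' Y''} g g' := by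
    ext x
    change QuotientAddGroup.mk (hF.cocyclesMap M n (g ≫ g') x) =
      QuotientAddGroup.mk (hF.cocyclesMap M n g' (hF.cocyclesMap M n g x))
    congr 1
    exact Subtype.ext (Category.assoc x.1 g g').symm

end Ext

/-! ### Operations on presentations -/

lemma fExact_of_isZero_left {S : ShortComplex C} (h : S.ShortExact) (h0 : IsZero S.X₁) :
    F.FExact S := by
  refine ⟨h, ?_⟩
  have : h.extClass = 0 := by
    rw [← Ext.comp_mk₀_id h.extClass, h0.eq_of_src (𝟙 S.X₁) 0, Ext.mk₀_zero, Ext.comp_zero]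
  rw [this]
  exact zero_mem _

/-- The direct sum of two sequences. -/
abbrev biprodComplex (S T : ShortComplex C) : ShortComplex C :=
  ShortComplex.mk (biprod.map S.f T.f) (biprod.map S.g T.g)
    (by ext <;> simp)

set_option linter.unusedSectionVars false in
lemma biprodComplex_shortExact {S T : ShortComplex C} (hS : S.ShortExact) (hT : T.ShortExact) :
    (biprodComplex S T).ShortExact := by
  have := hS.mono_f
  have := hT.mono_f
  have := hS.epi_g
  have := hT.epi_g
  refine ShortComplex.ShortExact.mk' ?_ ?_ ?_
  · rw [ShortComplex.exact_iff_exact_up_to_refinements]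
    intro A x hx
    have h1 : (x ≫ biprod.fst) ≫ S.g = 0 := by
      have := congrArg (fun t => t ≫ biprod.fst) hx
      simpa using this
    have h2 : (x ≫ biprod.snd) ≫ T.g = 0 := by
      have := congrArg (fun t => t ≫ biprod.snd) hx
      simpa using this
    refine ⟨A, 𝟙 A, inferInstance,
      biprod.lift (hS.exact.lift _ h1) (hT.exact.lift _ h2), ?_⟩
    ext <;> simp
  · change Mono (biprod.map S.f T.f)
    infer_instance
  · change Epi (biprod.map S.g T.g)
    infer_instance

lemma FExact.biprod {S T : ShortComplex C} (hS : F.FExact S) (hT : F.FExact T) :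
    F.FExact (biprodComplex S T) := by
  obtain ⟨hS, hS'⟩ := hS
  obtain ⟨hT, hT'⟩ := hT
  have hST := biprodComplex_shortExact hS hT
  refine ⟨hST, ?_⟩
  let p : biprodComplex S T ⟶ S :=
    { τ₁ := biprod.fst, τ₂ := biprod.fst, τ₃ := biprod.fst }
  let q : biprodComplex S T ⟶ T :=
    { τ₁ := biprod.snd, τ₂ := biprod.snd, τ₃ := biprod.snd }
  have key : hST.extClass =
      ((Ext.mk₀ p.τ₃).comp hS.extClass (zero_add 1)).comp
        (Ext.mk₀ (biprod.inl : S.X₁ ⟶ S.X₁ ⊞ T.X₁)) (add_zero 1) +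
      ((Ext.mk₀ q.τ₃).comp hT.extClass (zero_add 1)).comp
        (Ext.mk₀ (biprod.inr : T.X₁ ⟶ S.X₁ ⊞ T.X₁)) (add_zero 1) := by
    rw [← ShortComplex.ShortExact.extClass_naturality hST hS p,
      ← ShortComplex.ShortExact.extClass_naturality hST hT q,
      Ext.comp_assoc_of_third_deg_zero, Ext.comp_assoc_of_third_deg_zero,
      Ext.mk₀_comp_mk₀, Ext.mk₀_comp_mk₀, ← Ext.comp_add, ← Ext.mk₀_add]
    have : p.τ₁ ≫ biprod.inl + q.τ₁ ≫ biprod.inr = 𝟙 (S.X₁ ⊞ T.X₁) := biprod.total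
    rw [this]
    exact (Ext.comp_mk₀_id _).symm
  rw [key]
  exact add_mem (F.pushout_mem (F.pullback_mem _ hS') _)
    (F.pushout_mem (F.pullback_mem _ hT') _)

lemma FExact.of_iso {S T : ShortComplex C} (e : S ≅ T) (hS : F.FExact S) : F.FExact T := by
  obtain ⟨hS, hS'⟩ := hS
  have hT := ShortComplex.shortExact_of_iso e hS
  refine ⟨hT, ?_⟩
  have key : hT.extClass = (Ext.mk₀ e.inv.τ₃).comp
      (hS.extClass.comp (Ext.mk₀ e.hom.τ₁) (add_zero 1)) (zero_add 1) := by
    rw [ShortComplex.ShortExact.extClass_naturality hS hT e.hom, Ext.mk₀_comp_mk₀_assoc,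
      ← ShortComplex.comp_τ₃, e.inv_hom_id, ShortComplex.id_τ₃, Ext.mk₀_id_comp]
  rw [key]
  exact F.pullback_mem _ (F.pushout_mem hS' _)

variable {F}

lemma FProjective.biprod {P Q : C} (hP : F.FProjective P) (hQ : F.FProjective Q) :
    F.FProjective (P ⊞ Q) := by
  intro S hS f
  obtain ⟨a, ha⟩ := hP S hS (biprod.inl ≫ f)
  obtain ⟨b, hb⟩ := hQ S hS (biprod.inr ≫ f)
  exact ⟨biprod.desc a b, by ext <;> simp [ha, hb]⟩

/-- The direct sum of two presentations. -/
def Presentation.biprod {X Y N : C} (p : F.Presentation X) (q : F.Presentation Y)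
    (e : N ≅ X ⊞ Y) : F.Presentation N where
  K := p.K ⊞ q.K
  P := p.P ⊞ q.P
  ι := biprod.map p.ι q.ι
  π := biprod.map p.π q.π ≫ e.inv
  w := by
    rw [← Category.assoc]
    have : biprod.map p.ι q.ι ≫ biprod.map p.π q.π = 0 :=
      (biprodComplex (ShortComplex.mk _ _ p.w) (ShortComplex.mk _ _ q.w)).zero
    rw [this, zero_comp]
  exact := FExact.of_iso F (S := biprodComplex (ShortComplex.mk _ _ p.w) (ShortComplex.mk _ _ q.w))
    (ShortComplex.isoMk (Iso.refl _) (Iso.refl _) e.symm (by simp) (by simp))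
    (FExact.biprod F p.exact q.exact)
  proj := p.proj.biprod q.proj

/-- The presentation `0 ⟶ 0 ⟶ P ⟶ P ⟶ 0` of an `F`-projective object `P`. -/
def Presentation.ofProjective {P Z : C} (hP : F.FProjective P) (hZ : IsZero Z) :
    F.Presentation P where
  K := Z
  P := P
  ι := 0
  π := 𝟙 P
  w := zero_comp
  exact := by
    refine F.fExact_of_isZero_left ?_ hZ
    refine ShortComplex.ShortExact.mk' ?_ ?_ ?_
    · rw [ShortComplex.exact_iff_mono _ rfl]
      change Mono (𝟙 P)
      infer_instance
    · exact ⟨fun _ _ _ => hZ.eq_of_tgt _ _⟩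
    · change Epi (𝟙 P)
      infer_instance
  proj := hP

/-- The relative form of Schanuel's lemma. -/
lemma Presentation.schanuel {M : C} (p q : F.Presentation M) :
    Nonempty (p.K ⊞ q.P ≅ q.K ⊞ p.P) := by
  have hp := p.exact.1
  have hq := q.exact.1
  have mp : Mono p.ι := hp.mono_f
  have mq : Mono q.ι := hq.mono_f
  obtain ⟨a, ha⟩ := p.proj _ q.exact p.π
  obtain ⟨b, hb⟩ := q.proj _ p.exact q.π
  change p.P ⟶ q.P at a
  change q.P ⟶ p.P at b
  change a ≫ q.π = p.π at ha
  change b ≫ p.π = q.π at hb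
  have liftq : ∀ {X : C} (f : X ⟶ q.P), f ≫ q.π = 0 → ∃ g : X ⟶ q.K, g ≫ q.ι = f :=
    fun f hf => ⟨hq.exact.lift f hf, hq.exact.lift_f f hf⟩
  have liftp : ∀ {X : C} (f : X ⟶ p.P), f ≫ p.π = 0 → ∃ g : X ⟶ p.K, g ≫ p.ι = f :=
    fun f hf => ⟨hp.exact.lift f hf, hp.exact.lift_f f hf⟩
  obtain ⟨s, hs⟩ := liftq (p.ι ≫ a) (by rw [Category.assoc, ha, p.w])
  obtain ⟨t, ht⟩ := liftq (𝟙 q.P - b ≫ a) (by simp [Preadditive.sub_comp, ha, hb])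
  obtain ⟨s', hs'⟩ := liftp (q.ι ≫ b) (by rw [Category.assoc, hb, q.w])
  obtain ⟨t', ht'⟩ := liftp (𝟙 p.P - a ≫ b) (by simp [Preadditive.sub_comp, ha, hb])
  have e1 : s ≫ s' + p.ι ≫ t' = 𝟙 _ := by
    rw [← cancel_mono p.ι]
    simp only [Preadditive.add_comp, Category.assoc, hs', ht', Preadditive.comp_sub,
      Category.comp_id, Category.id_comp]
    rw [← Category.assoc s, hs]
    simp
  have e2 : s' ≫ s + q.ι ≫ t = 𝟙 _ := by
    rw [← cancel_mono q.ι]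
    simp only [Preadditive.add_comp, Category.assoc, hs, ht, Preadditive.comp_sub,
      Category.comp_id, Category.id_comp]
    rw [← Category.assoc s', hs']
    simp
  have e3 : t ≫ s' = b ≫ t' := by
    rw [← cancel_mono p.ι]
    simp only [Category.assoc, hs', ht']
    rw [← Category.assoc t, ht]
    simp [Preadditive.sub_comp, Preadditive.comp_sub]
  have e4 : t' ≫ s = a ≫ t := by
    rw [← cancel_mono q.ι]
    simp only [Category.assoc, hs, ht]
    rw [← Category.assoc t', ht']
    simp [Preadditive.sub_comp, Preadditive.comp_sub]
  exact ⟨{ hom := biprod.desc (biprod.lift s p.ι) (biprod.lift t (-b))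
           inv := biprod.desc (biprod.lift s' q.ι) (biprod.lift t' (-a))
           hom_inv_id := by
            ext <;> simp [biprod.lift_desc, Preadditive.add_comp, e1, hs, ht, e3]
           inv_hom_id := by
            ext <;> simp [biprod.lift_desc, Preadditive.add_comp, e2, hs', ht', e4] }⟩

/-! ### The group `K_F` and the relative Igusa–Todorov function -/

variable (F)

/-- The relations `[N] - [X] - [Y]` whenever `N ≅ X ⊞ Y`, and `[P]` whenever `P` is
`F`-projective. The former imply `[0] = 0` and hence `[N] = [N']` whenever `N ≅ N'`. -/
def relations : Set (FreeAbelianGroup C) :=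
  {r | ∃ N X Y : C, Nonempty (N ≅ X ⊞ Y) ∧
      r = FreeAbelianGroup.of N - FreeAbelianGroup.of X - FreeAbelianGroup.of Y} ∪
  {r | ∃ P : C, F.FProjective P ∧ r = FreeAbelianGroup.of P}

/-- The abelian group `K_F`: the free abelian group on the objects modulo the relations. -/
abbrev KGroup : Type u := FreeAbelianGroup C ⧸ AddSubgroup.closure F.relations

/-- The class `[M]` in `K_F`. -/
def cls (M : C) : F.KGroup := QuotientAddGroup.mk (FreeAbelianGroup.of M)

variable {F}

lemma cls_biprod {N X Y : C} (e : N ≅ X ⊞ Y) : F.cls N = F.cls X + F.cls Y := by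
  have h : FreeAbelianGroup.of N - FreeAbelianGroup.of X - FreeAbelianGroup.of Y ∈
      AddSubgroup.closure F.relations :=
    AddSubgroup.subset_closure (Or.inl ⟨N, X, Y, ⟨e⟩, rfl⟩)
  have h' := (QuotientAddGroup.eq_zero_iff _).2 h
  rw [QuotientAddGroup.mk_sub, QuotientAddGroup.mk_sub, sub_sub, sub_eq_zero] at h'
  exact h'

lemma cls_projective {P : C} (hP : F.FProjective P) : F.cls P = 0 :=
  (QuotientAddGroup.eq_zero_iff _).2 (AddSubgroup.subset_closure (Or.inr ⟨P, hP, rfl⟩))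

lemma fProjective_of_isZero {Z : C} (hZ : IsZero Z) : F.FProjective Z :=
  fun _ _ _ => ⟨0, hZ.eq_of_src _ _⟩

/-- The class of the relative syzygy does not depend on the chosen presentation. -/
lemma Presentation.cls_K_eq {M : C} (p q : F.Presentation M) : F.cls p.K = F.cls q.K := by
  obtain ⟨e⟩ := p.schanuel q
  have h1 := cls_biprod (F := F) (Iso.refl (p.K ⊞ q.P))
  have h2 := cls_biprod (F := F) e
  rw [h1, cls_projective q.proj, cls_projective p.proj, add_zero, add_zero] at h2
  exact h2

variable (hF : F.EnoughProjectives)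

/-- The endomorphism `Ω_F` of `K_F` induced by the relative syzygy: `Ω_F [M] = [K]` for any
`F`-exact sequence `0 ⟶ K ⟶ P ⟶ M ⟶ 0` with `P` an `F`-projective object. -/
def EnoughProjectives.omega : F.KGroup →+ F.KGroup :=
  QuotientAddGroup.lift _ (FreeAbelianGroup.lift fun M => F.cls (hF.presentation M).K) <| by
    rw [AddSubgroup.closure_le]
    rintro r (⟨N, X, Y, ⟨e⟩, rfl⟩ | ⟨P, hP, rfl⟩)
    · change FreeAbelianGroup.lift _ _ = 0
      rw [map_sub, map_sub, FreeAbelianGroup.lift_apply_of, FreeAbelianGroup.lift_apply_of,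
        FreeAbelianGroup.lift_apply_of, sub_sub, sub_eq_zero,
        Presentation.cls_K_eq (hF.presentation N)
          ((hF.presentation X).biprod (hF.presentation Y) e)]
      exact cls_biprod (Iso.refl _)
    · change FreeAbelianGroup.lift _ _ = 0
      rw [FreeAbelianGroup.lift_apply_of, Presentation.cls_K_eq (hF.presentation P)
        (Presentation.ofProjective hP (isZero_zero C))]
      exact cls_projective (fProjective_of_isZero (isZero_zero C))

/-- `Ω_F [M] = [K]` for every `F`-exact sequence `0 ⟶ K ⟶ P ⟶ M ⟶ 0` with `P` an `F`-projective
object. -/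
lemma EnoughProjectives.omega_cls {M : C} (p : F.Presentation M) :
    hF.omega (F.cls M) = F.cls p.K := by
  have h : hF.omega (F.cls M) = F.cls (hF.presentation M).K := by
    change FreeAbelianGroup.lift _ _ = _
    exact FreeAbelianGroup.lift_apply_of _ _
  rw [h]
  exact Presentation.cls_K_eq _ _

variable (F) in
/-- The subgroup `⟨M⟩` of `K_F` generated by the classes of the indecomposable direct summands
of `M` which are not `F`-projective. -/
def span (M : C) : AddSubgroup F.KGroup :=
  AddSubgroup.closure {x | ∃ N : C, Indecomposable N ∧ ¬ F.FProjective N ∧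
    (∃ N' : C, Nonempty (M ≅ N ⊞ N')) ∧ x = F.cls N}

/-- The set of `k` such that `Ω_F` restricts to a bijection from `Ω_F^m ⟨M⟩` onto
`Ω_F^{m+1} ⟨M⟩` for all `m ≥ k`. -/
def EnoughProjectives.stableIndices (M : C) : Set ℕ :=
  {k | ∀ m, k ≤ m → Set.BijOn hF.omega (hF.omega^[m] '' (F.span M : Set F.KGroup))
    (hF.omega^[m + 1] '' (F.span M : Set F.KGroup))}

/-- The relative Igusa–Todorov function `φ-dim_F`: the least `k` such that `Ω_F` restricts to
an isomorphism from `Ω_F^m ⟨M⟩` onto `Ω_F^{m+1} ⟨M⟩` for all `m ≥ k`. -/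
def EnoughProjectives.phiDim (M : C) : ℕ := sInf (hF.stableIndices M)

/-- `X` lies in `add M`: it is a direct summand of a finite direct sum of copies of `M`. -/
def InAdd (M X : C) : Prop :=
  haveI := Abelian.hasFiniteBiproducts (C := C)
  ∃ (n : ℕ) (X' : C), Nonempty ((⨁ fun _ : Fin n => M) ≅ X ⊞ X')

/-- The pair `(X, Y)` is a relative `d`-Division of `M`. -/
structure EnoughProjectives.IsDivision (M : C) (d : ℕ) (X Y : C) : Prop where
  pos : 0 < d
  left_mem : InAdd M X
  right_mem : InAdd M Y
  disjoint : ∀ Z : C, InAdd X Z → InAdd Y Z → IsZero Z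
  not_iso : ¬ Nonempty (hF.extFunctor X d ≅ hF.extFunctor Y d)
  iso : Nonempty (hF.extFunctor X (d + 1) ≅ hF.extFunctor Y (d + 1))

end AdditiveSubbifunctor

/-! ### Artin algebras -/

/-- The category of finitely generated left modules over an Artin `R`-algebra `A`, that is, over
an algebra `A` which is finitely generated as a module over a commutative artinian ring `R`. -/
def ArtinMod (R : Type w) (A : Type u) [CommRing R] [IsArtinianRing R] [Ring A] [Algebra R A]
    [Module.Finite R A] : Type (u + 1) :=
  FGModuleCat.{u} A

section

variable (R : Type w) (A : Type u) [CommRing R] [IsArtinianRing R] [Ring A] [Algebra R A]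
  [Module.Finite R A]

instance : Category.{u} (ArtinMod R A) := inferInstanceAs (Category.{u} (FGModuleCat.{u} A))

instance : Abelian (ArtinMod R A) :=
  have : IsNoetherianRing A := IsNoetherianRing.of_finite R A
  inferInstanceAs (Abelian (FGModuleCat.{u} A))

instance : HasExt.{u + 1} (ArtinMod R A) := HasExt.standard (ArtinMod R A)

end

end

end RelativeHomology

/-! Both sides of the formula measure where Ω_F fails to be injective on the groups Ω_F^d⟨M⟩.

The bridge is `extFunctor_iso_iff`: Ext^{n+1}_F(X,-) ≅ Ext^{n+1}_F(Y,-) exactly when Ω_F^n[X] =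
Ω_F^n[Y] in K_F. Dimension shift reduces this to Ext¹_F of the n-th syzygies. For a presentation 0 →
K → P → X → 0, Ext¹_F(X,-) is the cokernel of Hom(P,-) → Hom(K,-), so by Yoneda it determines X
modulo maps factoring through F-projectives, that is, up to adding F-projective summands.
Cancellation of direct summands identifies this relation with equality in K_F
(`projectivelyEquivalent_of_cls_eq`).

A (d+1)-Division is therefore a pair in add(M) without common summands whose classes differ after
Ω_F^d and agree after Ω_F^{d+1}; it shows that Ω_F is not injective on Ω_F^d⟨M⟩. Conversely, a
failure of injectivity there gives an element of ⟨M⟩ killed by Ω_F^{d+1} but not by Ω_F^d. Written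
as [X] - [Y] with common summands cancelled, it is a Division. Since Ω_F always maps Ω_F^m⟨M⟩ onto
Ω_F^{m+1}⟨M⟩, only injectivity matters. It holds for large m because ⟨M⟩ is a finitely generated
abelian group, on which the kernels of the iterates stabilize.

All this works in any abelian category satisfying `IsKrullSchmidt`; for modules over an Artin
algebra that condition comes from finite length and Fitting's lemma. -/

namespace RelativeHomology

/-! ### Cancellation and exchange for indecomposable summands -/

section KrullSchmidt

variable {C : Type u} [Category.{v} C] [Abelian C]

/-- An abelian category in which objects have a finite length that is additive on direct sums,
and in which the endomorphism rings of indecomposable objects are local. -/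
class IsKrullSchmidt (C : Type u) [Category.{v} C] [Abelian C] : Prop where
  exists_length : ∃ len : C → ℕ, (∀ {N X Y : C}, (N ≅ X ⊞ Y) → len N = len X + len Y) ∧
    ∀ X : C, len X = 0 → IsZero X
  isIso_or (N : C) (hN : Indecomposable N) (f : N ⟶ N) : IsIso f ∨ IsIso (𝟙 N - f)

lemma exists_iso_biprod_of_retract {N A : C} (i : N ⟶ A) (r : A ⟶ N) (h : i ≫ r = 𝟙 N) :
    ∃ B : C, Nonempty (A ≅ N ⊞ B) := by
  have hi : Mono i := ⟨fun a b hab => by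
    have := congrArg (fun t => t ≫ r) hab
    simpa [h] using this⟩
  let S : ShortComplex C := ShortComplex.mk i (cokernel.π i) (cokernel.condition i)
  have hS : S.Exact := ShortComplex.exact_of_g_is_cokernel _ (cokernelIsCokernel i)
  have : Epi S.g := inferInstanceAs (Epi (cokernel.π i))
  exact ⟨_, ⟨(ShortComplex.Splitting.ofExactOfRetraction S hS r h inferInstance).isoBinaryBiproduct⟩⟩

/-- If `α : N ⟶ N` is the corner of an isomorphism `N ⊞ A ≅ N ⊞ B` and `α + β ≫ u` is invertible
for the other component `β` and some `u`, then `A ≅ B`. -/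
lemma cancel_of_isIso {N A B : C} (φ : N ⊞ A ≅ N ⊞ B) (u : B ⟶ N)
    (h : IsIso (biprod.inl ≫ φ.hom ≫ biprod.fst + biprod.inl ≫ φ.hom ≫ biprod.snd ≫ u)) :
    Nonempty (A ≅ B) := by
  -- This shear replaces the corner α of φ by α + β ≫ u; once the corner is invertible, Gaussian
  -- elimination gives A ≅ B.
  let ψ : N ⊞ B ≅ N ⊞ B :=
    { hom := biprod.lift (biprod.fst + biprod.snd ≫ u) biprod.snd
      inv := biprod.lift (biprod.fst - biprod.snd ≫ u) biprod.snd
      hom_inv_id := by ext <;> simp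
      inv_hom_id := by ext <;> simp }
  have : IsIso (biprod.inl ≫ (φ ≪≫ ψ).hom ≫ biprod.fst) := by
    have e : biprod.inl ≫ (φ ≪≫ ψ).hom ≫ biprod.fst =
      biprod.inl ≫ φ.hom ≫ biprod.fst + biprod.inl ≫ φ.hom ≫ biprod.snd ≫ u := by simp [ψ]
    rw [e]
    exact h
  exact ⟨Biprod.isoElim (φ ≪≫ ψ)⟩

lemma isZero_left_of_biprod {X Y : C} (h : IsZero (X ⊞ Y)) : IsZero X := by
  rw [IsZero.iff_id_eq_zero]
  have := h.eq_of_src (biprod.fst) (0 : X ⊞ Y ⟶ X)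
  have h2 : (biprod.inl : X ⟶ X ⊞ Y) ≫ biprod.fst = 0 := by rw [this, comp_zero]
  simpa using h2

variable [IsKrullSchmidt C]

/-- The split monomorphism `a` gives N ≅ N ⊞ coker a, so additivity forces the cokernel to have
length zero. -/
lemma isIso_of_retract_self {N : C} (a b : N ⟶ N) (h : a ≫ b = 𝟙 N) : IsIso a := by
  obtain ⟨len, hlen, h0⟩ := IsKrullSchmidt.exists_length (C := C)
  have ha : Mono a := ⟨fun s t hst => by
    have := congrArg (fun t => t ≫ b) hst
    simpa [h] using this⟩
  let S : ShortComplex C := ShortComplex.mk a (cokernel.π a) (cokernel.condition a)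
  have hS : S.Exact := ShortComplex.exact_of_g_is_cokernel _ (cokernelIsCokernel a)
  have : Epi S.g := inferInstanceAs (Epi (cokernel.π a))
  have h1 := hlen (ShortComplex.Splitting.ofExactOfRetraction S hS b h inferInstance).isoBinaryBiproduct
  have h2 : IsZero (cokernel a) := h0 _ (by change len N = len N + len (cokernel a) at h1; omega)
  have : Epi a := Preadditive.epi_of_isZero_cokernel a h2
  exact isIso_of_mono_of_epi a

/-- The N-components of φ and its inverse satisfy α ≫ α' + β ≫ β' = 𝟙, so locality of End N makes
one of the two terms invertible. Either α is already an isomorphism, or a shear makes the corner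
invertible. -/
lemma Indecomposable.cancel {N A B : C} (hN : Indecomposable N) (φ : N ⊞ A ≅ N ⊞ B) :
    Nonempty (A ≅ B) := by
  let α := biprod.inl ≫ φ.hom ≫ biprod.fst
  let β := biprod.inl ≫ φ.hom ≫ biprod.snd
  let α' := biprod.inl ≫ φ.inv ≫ biprod.fst
  let β' := biprod.inr ≫ φ.inv ≫ biprod.fst
  have key : 𝟙 N - α ≫ α' = β ≫ β' := by
    have h : biprod.inl ≫ φ.hom ≫ (biprod.fst ≫ biprod.inl + biprod.snd ≫ biprod.inr) ≫
        φ.inv ≫ biprod.fst = 𝟙 N := by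
      rw [biprod.total]; simp
    rw [sub_eq_iff_eq_add, ← h]
    simp only [α, β, α', β', Preadditive.comp_add, Preadditive.add_comp, Category.assoc]
    rw [add_comm]
  rcases IsKrullSchmidt.isIso_or N hN (α ≫ α') with h | h
  · have hα : IsIso α := isIso_of_retract_self α (α' ≫ inv (α ≫ α'))
      (by rw [← Category.assoc, IsIso.hom_inv_id])
    exact cancel_of_isIso φ 0 (by simpa using hα)
  · rw [key] at h
    -- This u satisfies β ≫ u = 𝟙 - α, so the sheared corner is exactly 𝟙.
    refine cancel_of_isIso φ (β' ≫ inv (β ≫ β') ≫ (𝟙 N - α)) ?_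
    have e : biprod.inl ≫ φ.hom ≫ biprod.fst +
        biprod.inl ≫ φ.hom ≫ biprod.snd ≫ β' ≫ inv (β ≫ β') ≫ (𝟙 N - α) = 𝟙 N := by
      have : biprod.inl ≫ φ.hom ≫ biprod.snd ≫ β' ≫ inv (β ≫ β') ≫ (𝟙 N - α) = 𝟙 N - α := by
        have : biprod.inl ≫ φ.hom ≫ biprod.snd ≫ β' ≫ inv (β ≫ β') ≫ (𝟙 N - α) =
          (β ≫ β') ≫ inv (β ≫ β') ≫ (𝟙 N - α) := by simp only [β, Category.assoc]
        rw [this, IsIso.hom_inv_id_assoc]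
      rw [this]
      simp [α]
    rw [e]
    infer_instance

/-- An indecomposable direct summand of `A ⊞ B` is a direct summand of `A` or of `B`. -/
lemma Indecomposable.summand_of_summand_biprod {N N' A B : C} (hN : Indecomposable N)
    (φ : A ⊞ B ≅ N ⊞ N') :
    (∃ A', Nonempty (A ≅ N ⊞ A')) ∨ ∃ B', Nonempty (B ≅ N ⊞ B') := by
  let i := biprod.inl ≫ φ.inv
  let p := φ.hom ≫ biprod.fst
  have key : 𝟙 N - (i ≫ biprod.fst) ≫ biprod.inl ≫ p = (i ≫ biprod.snd) ≫ biprod.inr ≫ p := by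
    have h : i ≫ (biprod.fst ≫ biprod.inl + biprod.snd ≫ biprod.inr) ≫ p = 𝟙 N := by
      rw [biprod.total]; simp [i, p]
    rw [sub_eq_iff_eq_add, ← h]
    simp only [Preadditive.comp_add, Preadditive.add_comp, Category.assoc]
    rw [add_comm]
  rcases IsKrullSchmidt.isIso_or N hN ((i ≫ biprod.fst) ≫ biprod.inl ≫ p) with h | h
  · exact Or.inl (exists_iso_biprod_of_retract (i ≫ biprod.fst) ((biprod.inl ≫ p) ≫ inv _)
      (by rw [← Category.assoc, IsIso.hom_inv_id]))
  · rw [key] at h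
    exact Or.inr (exists_iso_biprod_of_retract (i ≫ biprod.snd) ((biprod.inr ≫ p) ≫ inv _)
      (by rw [← Category.assoc, IsIso.hom_inv_id]))

end KrullSchmidt

/-! ### The monoid of isomorphism classes -/

/-- The isomorphism classes of objects of `C`, a commutative monoid under direct sums. -/
def IsoClass (C : Type u) [Category.{v} C] : Type u := Quotient (isIsomorphicSetoid C)

namespace IsoClass

section

variable {C : Type u} [Category.{v} C]

/-- The isomorphism class of an object. -/
def mk (X : C) : IsoClass C := Quotient.mk _ X

lemma mk_eq_mk {X Y : C} : mk X = mk Y ↔ Nonempty (X ≅ Y) := Quotient.eq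

lemma mk_surjective : Function.Surjective (mk (C := C)) := Quotient.mk_surjective

end

variable {C : Type u} [Category.{v} C] [Abelian C]

noncomputable instance : Add (IsoClass C) :=
  ⟨Quotient.map₂ (fun X Y => X ⊞ Y) (fun _ _ ⟨e⟩ _ _ ⟨e'⟩ => ⟨biprod.mapIso e e'⟩)⟩

open scoped ZeroObject in
noncomputable instance : Zero (IsoClass C) := ⟨mk 0⟩

open scoped ZeroObject in
noncomputable instance : AddCommMonoid (IsoClass C) where
  nsmul := nsmulRec
  add_assoc := by
    rintro ⟨X⟩ ⟨Y⟩ ⟨Z⟩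
    exact Quotient.sound ⟨biprod.associator X Y Z⟩
  add_comm := by
    rintro ⟨X⟩ ⟨Y⟩
    exact Quotient.sound ⟨biprod.braiding X Y⟩
  zero_add := by
    rintro ⟨X⟩
    exact Quotient.sound ⟨biprod.braiding 0 X ≪≫ (isoBiprodZero (isZero_zero C)).symm⟩
  add_zero := by
    rintro ⟨X⟩
    exact Quotient.sound ⟨(isoBiprodZero (isZero_zero C)).symm⟩

lemma mk_biprod (X Y : C) : mk (X ⊞ Y) = mk X + mk Y := rfl

lemma mk_eq_add {N X Y : C} : mk N = mk X + mk Y ↔ Nonempty (N ≅ X ⊞ Y) := by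
  rw [← mk_biprod, mk_eq_mk]

open scoped ZeroObject in
lemma mk_eq_zero {X : C} : mk X = 0 ↔ IsZero X := by
  change mk X = mk 0 ↔ _
  rw [mk_eq_mk]
  exact ⟨fun ⟨e⟩ => (isZero_zero C).of_iso e, fun h => ⟨h.iso (isZero_zero C)⟩⟩

lemma eq_zero_of_add_eq_zero {x y : IsoClass C} (h : x + y = 0) : x = 0 := by
  obtain ⟨X, rfl⟩ := mk_surjective x
  obtain ⟨Y, rfl⟩ := mk_surjective y
  rw [← mk_biprod, mk_eq_zero] at h
  exact mk_eq_zero.2 (isZero_left_of_biprod h)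

lemma mk_biproduct (M : C) (n : ℕ) :
    have := Abelian.hasFiniteBiproducts (C := C)
    mk (⨁ fun _ : Fin n => M) = n • mk M := by
  have := Abelian.hasFiniteBiproducts (C := C)
  induction n with
  | zero =>
    rw [zero_smul, mk_eq_zero, IsZero.iff_id_eq_zero]
    ext i
    exact i.elim0
  | succ n ih =>
    rw [succ_nsmul', ← ih, mk_eq_add]
    refine ⟨⟨biprod.lift (biproduct.π _ 0) (biproduct.lift fun j => biproduct.π _ j.succ),
      biprod.desc (biproduct.ι (fun _ : Fin (n + 1) => M) 0)
        (biproduct.desc fun j => biproduct.ι (fun _ : Fin (n + 1) => M) j.succ), ?_, ?_⟩⟩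
    · rw [biprod.lift_desc, biproduct.lift_desc, ← biproduct.total, Fin.sum_univ_succ]
    · ext i j
      · simp
      · simp [biproduct.ι_π_ne _ (Fin.succ_ne_zero _).symm]
      · simp [biproduct.ι_π_ne _ (Fin.succ_ne_zero _)]
      · by_cases h : i = j
        · subst h; simp
        · simp [biproduct.ι_π_ne _ h, biproduct.ι_π_ne _ (fun h' => h (Fin.succ_injective _ h'))]

/-- Multiples of an isomorphism class, up to direct summands. -/
lemma inAdd_iff {M X : C} :
    AdditiveSubbifunctor.InAdd M X ↔ ∃ (n : ℕ) (x' : IsoClass C), n • mk M = mk X + x' := by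
  unfold AdditiveSubbifunctor.InAdd
  constructor
  · rintro ⟨n, X', h⟩
    exact ⟨n, mk X', by rw [← mk_biproduct]; exact mk_eq_add.2 h⟩
  · rintro ⟨n, x', h⟩
    obtain ⟨X', rfl⟩ := mk_surjective x'
    rw [← mk_biproduct] at h
    exact ⟨n, X', mk_eq_add.1 h⟩

/-- The isomorphism class is that of an indecomposable object. -/
def IsIndecomposable (x : IsoClass C) : Prop := x ≠ 0 ∧ ∀ y z, x = y + z → y = 0 ∨ z = 0

lemma isIndecomposable_mk {N : C} : IsIndecomposable (mk N) ↔ Indecomposable N := by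
  refine and_congr (not_congr mk_eq_zero) ⟨fun h Y Z e => ?_, fun h y z e => ?_⟩
  · simpa only [mk_eq_zero] using h (mk Y) (mk Z) (mk_eq_add.2 ⟨e⟩)
  · obtain ⟨Y, rfl⟩ := mk_surjective y
    obtain ⟨Z, rfl⟩ := mk_surjective z
    obtain ⟨e⟩ := mk_eq_add.1 e
    simpa only [mk_eq_zero] using h Y Z e

section

variable [IsKrullSchmidt C]

-- Isomorphism invariance of the length is not assumed; it follows from additivity applied to
-- decompositions with a zero summand.
variable (C) in
lemma exists_length : ∃ len : IsoClass C →+ ℕ, ∀ x, len x = 0 → x = 0 := by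
  obtain ⟨len, hlen, h0⟩ := IsKrullSchmidt.exists_length (C := C)
  have hz : ∀ Z : C, IsZero Z → len Z = 0 := fun Z hZ => by
    have := hlen (isoBiprodZero (X := Z) hZ)
    omega
  have hiso : ∀ X Y : C, (X ≅ Y) → len X = len Y := fun X Y e => by
    have := hlen (e ≪≫ isoBiprodZero (X := Y) (isZero_zero C))
    rw [hz _ (isZero_zero C)] at this
    exact this
  refine ⟨{ toFun := Quotient.lift len fun X Y ⟨e⟩ => hiso X Y e
            map_zero' := hz _ (isZero_zero C)
            map_add' := ?_ }, ?_⟩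
  · rintro ⟨X⟩ ⟨Y⟩
    exact hlen (Iso.refl (X ⊞ Y))
  · rintro ⟨X⟩ h
    exact mk_eq_zero.2 (h0 X h)

/-- Induction along direct sum decompositions. -/
lemma induction_on {p : IsoClass C → Prop} (x : IsoClass C) (zero : p 0)
    (indec : ∀ n, IsIndecomposable n → p n)
    (add : ∀ x y, p x → p y → p (x + y)) : p x := by
  obtain ⟨len, h0⟩ := exists_length C
  induction h : len x using Nat.strong_induction_on generalizing x with
  | _ k ih =>
    by_cases hx : x = 0
    · rw [hx]; exact zero
    by_cases hi : IsIndecomposable x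
    · exact indec x hi
    · simp only [IsIndecomposable, not_and, not_forall, not_or] at hi
      obtain ⟨y, z, rfl, hy, hz⟩ := hi hx
      have hy' : len y ≠ 0 := fun h => hy (h0 y h)
      have hz' : len z ≠ 0 := fun h => hz (h0 z h)
      rw [map_add] at h
      exact add _ _ (ih (len y) (by omega) y rfl) (ih (len z) (by omega) z rfl)

/-- Cancellation of one indecomposable summand extends to any object by splitting it into
indecomposables. -/
instance : IsCancelAdd (IsoClass C) := by
  suffices h : ∀ a : IsoClass C, ∀ b c, a + b = a + c → b = c from
    { add_left_cancel := fun a b c => h a b c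
      add_right_cancel := fun a b c e => h a b c (by
        change b + a = c + a at e
        rwa [add_comm b, add_comm c] at e) }
  intro a
  induction a using induction_on with
  | zero => intro b c h; simpa using h
  | indec n hn =>
    intro b c h
    obtain ⟨N, rfl⟩ := mk_surjective n
    obtain ⟨B, rfl⟩ := mk_surjective b
    obtain ⟨D, rfl⟩ := mk_surjective c
    rw [← mk_biprod, ← mk_biprod, mk_eq_mk] at h
    exact mk_eq_mk.2 (Indecomposable.cancel (isIndecomposable_mk.1 hn) h.some)
  | add x y hx hy =>
    intro b c h
    rw [add_assoc, add_assoc] at h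
    exact hy _ _ (hx _ _ h)

lemma IsIndecomposable.summand_of_add {n n' a b : IsoClass C} (hn : IsIndecomposable n)
    (h : a + b = n + n') : (∃ a', a = n + a') ∨ ∃ b', b = n + b' := by
  obtain ⟨N, rfl⟩ := mk_surjective n
  obtain ⟨N', rfl⟩ := mk_surjective n'
  obtain ⟨A, rfl⟩ := mk_surjective a
  obtain ⟨B, rfl⟩ := mk_surjective b
  rw [← mk_biprod, ← mk_biprod, mk_eq_mk] at h
  rcases Indecomposable.summand_of_summand_biprod (isIndecomposable_mk.1 hn) h.some with
    ⟨A', h⟩ | ⟨B', h⟩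
  · exact Or.inl ⟨mk A', mk_eq_add.2 h⟩
  · exact Or.inr ⟨mk B', mk_eq_add.2 h⟩

lemma IsIndecomposable.summand_of_nsmul {n n' m : IsoClass C} (hn : IsIndecomposable n) {k : ℕ}
    (h : k • m = n + n') : ∃ m', m = n + m' := by
  induction k generalizing n' with
  | zero =>
    rw [zero_smul] at h
    exact absurd (eq_zero_of_add_eq_zero h.symm) hn.1
  | succ k ih =>
    rw [succ_nsmul] at h
    rcases hn.summand_of_add h with ⟨a, ha⟩ | h
    · exact ih ha
    · exact h

lemma exists_indecomposable_summand {x : IsoClass C} (hx : x ≠ 0) :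
    ∃ n x', IsIndecomposable n ∧ x = n + x' := by
  induction x using induction_on with
  | zero => exact absurd rfl hx
  | indec n hn => exact ⟨n, 0, hn, (add_zero n).symm⟩
  | add x y hx' hy' =>
    by_cases h : x = 0
    · obtain ⟨n, z, hn, e⟩ := hy' (by rintro rfl; exact hx (by rw [h, add_zero]))
      exact ⟨n, z, hn, by rw [h, zero_add, e]⟩
    · obtain ⟨n, z, hn, e⟩ := hx' h
      exact ⟨n, z + y, hn, by rw [e, add_assoc]⟩

/-- By the exchange property, an indecomposable summand of x + y is already one of x or of y, so
finiteness passes to sums. -/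
lemma finite_indecomposable_summands (x : IsoClass C) :
    {n | IsIndecomposable n ∧ ∃ x', x = n + x'}.Finite := by
  induction x using induction_on with
  | zero =>
    convert Set.finite_empty
    ext n
    simp only [Set.mem_ofPred_eq, Set.mem_empty_iff_false, iff_false, not_and, not_exists]
    exact fun hn x' h => hn.1 (eq_zero_of_add_eq_zero h.symm)
  | indec m hm =>
    refine (Set.finite_singleton m).subset ?_
    rintro n ⟨hn, x', h⟩
    rcases hm.2 _ _ h with h' | h'
    · exact absurd h' hn.1
    · rw [h, h', add_zero]; rfl
  | add x y hx hy =>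
    refine (hx.union hy).subset ?_
    rintro n ⟨hn, x', h⟩
    rcases hn.summand_of_add h with h | h
    · exact Or.inl ⟨hn, h⟩
    · exact Or.inr ⟨hn, h⟩

/-- A pair of isomorphism classes can be stripped of all its common direct summands. -/
lemma exists_disjoint (x y : IsoClass C) : ∃ x' y' z, x = x' + z ∧ y = y' + z ∧
    ∀ n, IsIndecomposable n → (∃ a, x' = n + a) → (∃ b, y' = n + b) → False := by
  obtain ⟨len, h0⟩ := exists_length C
  induction h : len x using Nat.strong_induction_on generalizing x y with
  | _ k ih =>
    by_cases H : ∀ n, IsIndecomposable n → (∃ a, x = n + a) → (∃ b, y = n + b) → False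
    · exact ⟨x, y, 0, by simp, by simp, H⟩
    · push Not at H
      obtain ⟨n, hn, ⟨a, rfl⟩, ⟨b, rfl⟩, -⟩ := H
      have hn' : len n ≠ 0 := fun h => hn.1 (h0 n h)
      rw [map_add] at h
      obtain ⟨x', y', z, rfl, rfl, H⟩ := ih (len a) (by omega) a b rfl
      -- Removing a common indecomposable n lowers the length of x; n joins the common part.
      exact ⟨x', y', z + n, by abel, by abel, H⟩

end

end IsoClass

namespace AdditiveSubbifunctor

variable {C : Type u} [Category.{v} C] [Abelian C] [HasExt.{w} C]
  {F : AdditiveSubbifunctor.{w} C}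

lemma FProjective.of_retract {P B : C} (hP : F.FProjective P) (i : B ⟶ P) (r : P ⟶ B)
    (h : i ≫ r = 𝟙 B) : F.FProjective B := by
  intro S hS f
  obtain ⟨g, hg⟩ := hP S hS (r ≫ f)
  exact ⟨i ≫ g, by rw [Category.assoc, hg, ← Category.assoc, h, Category.id_comp]⟩

/-! ### Stable isomorphisms -/

/-- The two presented objects are isomorphic modulo maps factoring through `F`-projectives. -/
def Presentation.StablyIso {X Y : C} (p : F.Presentation X) (q : F.Presentation Y) : Prop :=
  ∃ (f : X ⟶ Y) (g : Y ⟶ X) (h : X ⟶ p.P) (k : Y ⟶ q.P),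
    f ≫ g + h ≫ p.π = 𝟙 X ∧ g ≫ f + k ≫ q.π = 𝟙 Y

/-- `X` and `Y` become isomorphic after adding `F`-projective direct summands. -/
def ProjectivelyEquivalent (F : AdditiveSubbifunctor.{w} C) (X Y : C) : Prop :=
  ∃ P Q : C, F.FProjective P ∧ F.FProjective Q ∧ Nonempty (X ⊞ P ≅ Y ⊞ Q)

/-- The map (f, h) : X ⟶ Y ⊞ p.P is split by (g, p.π), so Y ⊞ p.P ≅ X ⊞ coker. The complementary
idempotent factors through an F-projective, which makes the cokernel F-projective. -/
lemma Presentation.StablyIso.projectivelyEquivalent {X Y : C} {p : F.Presentation X}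
    {q : F.Presentation Y} (H : p.StablyIso q) : F.ProjectivelyEquivalent X Y := by
  obtain ⟨f, g, h, k, h1, h2⟩ := H
  let i : X ⟶ Y ⊞ p.P := biprod.lift f h
  let r : Y ⊞ p.P ⟶ X := biprod.desc g p.π
  have hir : i ≫ r = 𝟙 X := by simp only [i, r, biprod.lift_desc, h1]
  have hi : Mono i := ⟨fun s t hst => by
    have := congrArg (fun t => t ≫ r) hst
    simpa [hir] using this⟩
  let S : ShortComplex C := ShortComplex.mk i (cokernel.π i) (cokernel.condition i)
  have hS : S.Exact := ShortComplex.exact_of_g_is_cokernel _ (cokernelIsCokernel i)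
  have : Epi S.g := inferInstanceAs (Epi (cokernel.π i))
  let σ := ShortComplex.Splitting.ofExactOfRetraction S hS r hir inferInstance
  refine ⟨cokernel i, p.P, ?_, p.proj, ⟨σ.isoBinaryBiproduct.symm⟩⟩
  let s : cokernel i ⟶ Y ⊞ p.P := σ.s
  let t : Y ⊞ p.P ⟶ cokernel i := cokernel.π i
  have hst : s ≫ t = 𝟙 _ := σ.s_g
  have hts : t ≫ s = 𝟙 _ - r ≫ i := by
    rw [eq_sub_iff_add_eq, add_comm]
    exact σ.id
  -- On Y the idempotent 𝟙 - r ≫ i has components (k ≫ q.π, -g ≫ h), which factor through q.P and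
  -- the first p.P; the second p.P carries its restriction to p.P.
  let a : Y ⊞ p.P ⟶ q.P ⊞ (p.P ⊞ p.P) :=
    biprod.lift (biprod.fst ≫ k) (biprod.lift (biprod.fst ≫ g ≫ h) biprod.snd)
  let b : q.P ⊞ (p.P ⊞ p.P) ⟶ Y ⊞ p.P :=
    biprod.desc (q.π ≫ biprod.inl) (biprod.desc (-biprod.inr) (biprod.inr - p.π ≫ i))
  have hab : a ≫ b = t ≫ s := by
    have h2' : k ≫ q.π = 𝟙 Y - g ≫ f := by rw [← h2]; abel
    rw [hts]
    apply biprod.hom_ext'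
    · apply biprod.hom_ext
      · simp [a, b, r, i, biprod.lift_desc, h2']
      · simp [a, b, r, i, biprod.lift_desc]
    · apply biprod.hom_ext
      · simp [a, b, r, i, biprod.lift_desc]
      · simp [a, b, r, i, biprod.lift_desc]
  refine (q.proj.biprod (p.proj.biprod p.proj)).of_retract (s ≫ a) (b ≫ t) ?_
  rw [Category.assoc, reassoc_of% hab, reassoc_of% hst]
  exact hst

/-- The corners of the isomorphism compose to the identity up to maps through Q or P, and
F-projectivity lifts these along the presentations. -/
lemma ProjectivelyEquivalent.stablyIso {X Y : C} (H : F.ProjectivelyEquivalent X Y)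
    (p : F.Presentation X) (q : F.Presentation Y) : p.StablyIso q := by
  obtain ⟨P, Q, hP, hQ, ⟨φ⟩⟩ := H
  obtain ⟨h, hh⟩ := hQ _ p.exact (biprod.inr ≫ φ.inv ≫ biprod.fst)
  obtain ⟨k, hk⟩ := hP _ q.exact (biprod.inr ≫ φ.hom ≫ biprod.fst)
  change h ≫ p.π = _ at hh
  change k ≫ q.π = _ at hk
  refine ⟨biprod.inl ≫ φ.hom ≫ biprod.fst, biprod.inl ≫ φ.inv ≫ biprod.fst,
    (biprod.inl ≫ φ.hom ≫ biprod.snd) ≫ h, (biprod.inl ≫ φ.inv ≫ biprod.snd) ≫ k, ?_, ?_⟩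
  · have : biprod.inl ≫ φ.hom ≫ (biprod.fst ≫ biprod.inl + biprod.snd ≫ biprod.inr) ≫
        φ.inv ≫ biprod.fst = 𝟙 X := by
      rw [biprod.total]; simp
    rw [← this, Category.assoc, Category.assoc, Category.assoc, hh]
    simp only [Preadditive.comp_add, Preadditive.add_comp, Category.assoc]
  · have : biprod.inl ≫ φ.inv ≫ (biprod.fst ≫ biprod.inl + biprod.snd ≫ biprod.inr) ≫
        φ.hom ≫ biprod.fst = 𝟙 Y := by
      rw [biprod.total]; simp
    rw [← this, Category.assoc, Category.assoc, Category.assoc, hk]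
    simp only [Preadditive.comp_add, Preadditive.add_comp, Category.assoc]

lemma ProjectivelyEquivalent.cls_eq {X Y : C} (H : F.ProjectivelyEquivalent X Y) :
    F.cls X = F.cls Y := by
  obtain ⟨P, Q, hP, hQ, ⟨φ⟩⟩ := H
  have h1 := cls_biprod (F := F) (Iso.refl (X ⊞ P))
  have h2 := cls_biprod (F := F) φ
  rw [h1, cls_projective hP, cls_projective hQ, add_zero, add_zero] at h2
  exact h2

open scoped ZeroObject in
/-- By Krull-Schmidt, equality in `K_F` is equivalence up to `F`-projective summands. -/
lemma projectivelyEquivalent_of_cls_eq [IsKrullSchmidt C] {X Y : C} (h : F.cls X = F.cls Y) :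
    F.ProjectivelyEquivalent X Y := by
  let G := Algebra.GrothendieckAddGroup (IsoClass C)
  let of : IsoClass C →+ G := Algebra.GrothendieckAddGroup.of
  let φ : FreeAbelianGroup C →+ G := FreeAbelianGroup.lift fun X => of (IsoClass.mk X)
  have hφ : ∀ X, φ (FreeAbelianGroup.of X) = of (IsoClass.mk X) :=
    fun X => FreeAbelianGroup.lift_apply_of _ _
  -- In the Grothendieck group of isomorphism classes, sum relations vanish, and so every relation
  -- becomes a difference of two F-projective classes. Since the monoid is cancellative, it embeds
  -- there and the resulting equation yields an isomorphism.
  have key : ∀ r ∈ AddSubgroup.closure F.relations, ∃ P Q, F.FProjective P ∧ F.FProjective Q ∧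
      φ r = of (IsoClass.mk P) - of (IsoClass.mk Q) := by
    intro r hr
    have hzero : F.FProjective (0 : C) := fProjective_of_isZero (isZero_zero C)
    have hmk : of (IsoClass.mk (0 : C)) = 0 := by
      rw [IsoClass.mk_eq_zero.2 (isZero_zero C), map_zero]
    induction hr using AddSubgroup.closure_induction with
    | mem r hr =>
      rcases hr with ⟨N, X, Y, e, rfl⟩ | ⟨P, hP, rfl⟩
      · refine ⟨0, 0, hzero, hzero, ?_⟩
        rw [map_sub, map_sub, hφ, hφ, hφ, IsoClass.mk_eq_add.2 e, map_add]
        abel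
      · exact ⟨P, 0, hP, hzero, by rw [hφ, hmk, sub_zero]⟩
    | zero => exact ⟨0, 0, hzero, hzero, by rw [map_zero, sub_self]⟩
    | add r s _ _ hr hs =>
      obtain ⟨P, Q, hP, hQ, e⟩ := hr
      obtain ⟨P', Q', hP', hQ', e'⟩ := hs
      refine ⟨P ⊞ P', Q ⊞ Q', hP.biprod hP', hQ.biprod hQ', ?_⟩
      rw [map_add, e, e', IsoClass.mk_biprod, IsoClass.mk_biprod, map_add, map_add]
      abel
    | neg r _ hr =>
      obtain ⟨P, Q, hP, hQ, e⟩ := hr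
      exact ⟨Q, P, hQ, hP, by rw [map_neg, e, neg_sub]⟩
  obtain ⟨P, Q, hP, hQ, e⟩ := key _ (QuotientAddGroup.eq.1 h)
  rw [map_add, map_neg, hφ, hφ, neg_add_eq_sub, sub_eq_sub_iff_add_eq_add, add_comm (of _),
    ← map_add, ← map_add] at e
  refine ⟨P, Q, hP, hQ, ?_⟩
  rw [← IsoClass.mk_eq_mk, IsoClass.mk_biprod, IsoClass.mk_biprod]
  have e' := Algebra.GrothendieckAddGroup.of_injective e
  rw [add_comm, ← e', add_comm]

/-! ### Recovering a presented object from its relative `Ext¹` -/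

/-- An identification of `G` with the cokernel of `Hom(P, -) ⟶ Hom(K, -)`, that is, with
`Ext¹_F(X, -)`, for a presentation `0 ⟶ K ⟶ P ⟶ X ⟶ 0`. -/
structure Presentation.ExtOne {X : C} (p : F.Presentation X) (G : C ⥤ AddCommGrpCat.{v}) where
  δ (Z : C) : (p.K ⟶ Z) →+ G.obj Z
  surjective (Z : C) : Function.Surjective (δ Z)
  naturality {Z Z' : C} (a : p.K ⟶ Z) (g : Z ⟶ Z') : G.map g (δ Z a) = δ Z' (a ≫ g)
  eq_zero_iff {Z : C} (a : p.K ⟶ Z) : δ Z a = 0 ↔ ∃ b : p.P ⟶ Z, p.ι ≫ b = a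

lemma Presentation.exists_lift {X Y : C} (p : F.Presentation X) (q : F.Presentation Y)
    (f : X ⟶ Y) : ∃ (u : p.K ⟶ q.K) (v : p.P ⟶ q.P), u ≫ q.ι = p.ι ≫ v ∧ v ≫ q.π = p.π ≫ f := by
  have mq : Mono q.ι := q.exact.1.mono_f
  obtain ⟨v, hv⟩ := p.proj _ q.exact (p.π ≫ f)
  change p.P ⟶ q.P at v
  change v ≫ q.π = _ at hv
  have hz : (p.ι ≫ v) ≫ q.π = 0 := by rw [Category.assoc, hv, reassoc_of% p.w, zero_comp]
  exact ⟨q.exact.1.exact.lift (p.ι ≫ v) hz, v, q.exact.1.exact.lift_f (p.ι ≫ v) hz, hv⟩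

/-- A lift of a map factoring through the `F`-projective `q.P` factors through `p.ι`. -/
lemma Presentation.exists_factor {X Y : C} (p : F.Presentation X) (q : F.Presentation Y)
    {u : p.K ⟶ q.K} {v : p.P ⟶ q.P} (huv : u ≫ q.ι = p.ι ≫ v) (h : X ⟶ q.P)
    (hv : v ≫ q.π = p.π ≫ h ≫ q.π) : ∃ s : p.P ⟶ q.K, u = p.ι ≫ s := by
  have mq : Mono q.ι := q.exact.1.mono_f
  have hz : (v - p.π ≫ h) ≫ q.π = 0 := by
    rw [Preadditive.sub_comp, hv, Category.assoc, sub_self]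
  refine ⟨q.exact.1.exact.lift (v - p.π ≫ h) hz, ?_⟩
  have := q.exact.1.exact.lift_f (v - p.π ≫ h) hz
  change q.exact.1.exact.lift (v - p.π ≫ h) hz ≫ q.ι = _ at this
  rw [← cancel_mono q.ι, huv, Category.assoc, this, Preadditive.comp_sub, reassoc_of% p.w,
    zero_comp, sub_zero]

namespace Presentation.ExtOne

variable {X Y : C} {p : F.Presentation X} {q : F.Presentation Y} {G H : C ⥤ AddCommGrpCat.{v}}

/-- The transformation induced by a morphism of presentations. -/
lemma exists_map (G' : p.ExtOne G) (H' : q.ExtOne H) (u : p.K ⟶ q.K) (v : p.P ⟶ q.P)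
    (huv : u ≫ q.ι = p.ι ≫ v) :
    ∃ η : H ⟶ G, ∀ (Z : C) (a : q.K ⟶ Z), η.app Z (H'.δ Z a) = G'.δ Z (u ≫ a) := by
  let t (Z : C) : H.obj Z →+ G.obj Z := (H'.δ Z).liftOfSurjective (H'.surjective Z)
    ⟨(G'.δ Z).comp (Preadditive.leftComp Z u), fun a ha => by
      obtain ⟨b, rfl⟩ := (H'.eq_zero_iff a).1 ha
      refine (G'.eq_zero_iff _).2 ⟨v ≫ b, ?_⟩
      change _ = u ≫ _
      rw [reassoc_of% huv]⟩
  have ht (Z : C) (a : q.K ⟶ Z) : t Z (H'.δ Z a) = G'.δ Z (u ≫ a) :=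
    AddMonoidHom.liftOfRightInverse_comp_apply _ _ _ _ a
  refine ⟨{ app := fun Z => AddCommGrpCat.ofHom (t Z), naturality := fun Z Z' g => ?_ }, ht⟩
  ext x
  obtain ⟨a, rfl⟩ := H'.surjective Z x
  change t Z' (H.map g (H'.δ Z a)) = G.map g (t Z (H'.δ Z a))
  rw [H'.naturality, ht, ht, G'.naturality, Category.assoc]

lemma hom_ext (H' : q.ExtOne H) {η θ : H ⟶ G}
    (h : ∀ (Z : C) (a : q.K ⟶ Z), η.app Z (H'.δ Z a) = θ.app Z (H'.δ Z a)) : η = θ := by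
  ext Z x
  obtain ⟨a, rfl⟩ := H'.surjective Z x
  exact h Z a

/-- Stably isomorphic objects have isomorphic relative `Ext¹`. -/
lemma nonempty_iso (G' : p.ExtOne G) (H' : q.ExtOne H) (h : p.StablyIso q) :
    Nonempty (G ≅ H) := by
  obtain ⟨f, g, h, k, h1, h2⟩ := h
  obtain ⟨u, v, huv, hv⟩ := p.exists_lift q f
  obtain ⟨u', v', huv', hv'⟩ := q.exists_lift p g
  obtain ⟨η, hη⟩ := exists_map G' H' u v huv
  obtain ⟨θ, hθ⟩ := exists_map H' G' u' v' huv'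
  -- Since 𝟙 - f ≫ g factors through p.P, its lift 𝟙 - u ≫ u' factors through p.ι and acts as zero
  -- on Ext¹_F.
  obtain ⟨s, hs⟩ := p.exists_factor p (u := 𝟙 _ - u ≫ u') (v := 𝟙 _ - v ≫ v')
    (by simp [Preadditive.sub_comp, Preadditive.comp_sub, huv', reassoc_of% huv]) h
    (by
      have : h ≫ p.π = 𝟙 X - f ≫ g := by rw [← h1]; abel
      simp [Preadditive.sub_comp, Preadditive.comp_sub, hv', reassoc_of% hv, this])
  obtain ⟨s', hs'⟩ := q.exists_factor q (u := 𝟙 _ - u' ≫ u) (v := 𝟙 _ - v' ≫ v)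
    (by simp [Preadditive.sub_comp, Preadditive.comp_sub, huv, reassoc_of% huv']) k
    (by
      have : k ≫ q.π = 𝟙 Y - g ≫ f := by rw [← h2]; abel
      simp [Preadditive.sub_comp, Preadditive.comp_sub, hv, reassoc_of% hv', this])
  refine ⟨θ, η, G'.hom_ext fun Z a => ?_, H'.hom_ext fun Z a => ?_⟩
  · change η.app Z (θ.app Z (G'.δ Z a)) = G'.δ Z a
    rw [hθ, hη, ← sub_eq_zero, ← neg_eq_zero, neg_sub, ← map_sub]
    refine (G'.eq_zero_iff _).2 ⟨s ≫ a, ?_⟩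
    rw [← Category.assoc, ← hs, Preadditive.sub_comp, Category.id_comp, Category.assoc]
  · change θ.app Z (η.app Z (H'.δ Z a)) = H'.δ Z a
    rw [hη, hθ, ← sub_eq_zero, ← neg_eq_zero, neg_sub, ← map_sub]
    refine (H'.eq_zero_iff _).2 ⟨s' ≫ a, ?_⟩
    rw [← Category.assoc, ← hs', Preadditive.sub_comp, Category.id_comp, Category.assoc]

/-- By Yoneda, every transformation between relative `Ext¹` functors is induced by a morphism of
presentations. -/
lemma exists_of_natTrans (G' : p.ExtOne G) (H' : q.ExtOne H) (η : H ⟶ G) :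
    ∃ (u : p.K ⟶ q.K) (v : p.P ⟶ q.P) (f : X ⟶ Y), u ≫ q.ι = p.ι ≫ v ∧ v ≫ q.π = p.π ≫ f ∧
      ∀ (Z : C) (a : q.K ⟶ Z), η.app Z (H'.δ Z a) = G'.δ Z (u ≫ a) := by
  have ep : Epi p.π := p.exact.1.epi_g
  -- Yoneda: η is determined by its value on the class of 𝟙 q.K, and u is any representative of that
  -- value.
  obtain ⟨u, hu⟩ := G'.surjective _ (η.app _ (H'.δ _ (𝟙 q.K)))
  have hη : ∀ (Z : C) (a : q.K ⟶ Z), η.app Z (H'.δ Z a) = G'.δ Z (u ≫ a) := by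
    intro Z a
    have e := H'.naturality (𝟙 q.K) a
    rw [Category.id_comp] at e
    rw [← e, ← G'.naturality, hu]
    exact ConcreteCategory.congr_hom (η.naturality a) (H'.δ _ (𝟙 q.K))
  -- The class of q.ι is zero because q.ι extends to 𝟙 q.P; hence u ≫ q.ι extends over p.P, and f is
  -- induced on the cokernels.
  obtain ⟨v, hv⟩ := (G'.eq_zero_iff (u ≫ q.ι)).1 (by
    rw [← hη, (H'.eq_zero_iff q.ι).2 ⟨𝟙 _, Category.comp_id _⟩, map_zero])
  have hz : p.ι ≫ v ≫ q.π = 0 := by rw [reassoc_of% hv, q.w, comp_zero]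
  exact ⟨u, v, p.exact.1.exact.desc (v ≫ q.π) hz, hv.symm,
    (p.exact.1.exact.g_desc (v ≫ q.π) hz).symm, hη⟩

/-- A morphism acting as the identity on the relative `Ext¹` is the identity modulo maps factoring
through an `F`-projective. -/
lemma exists_factor (G' : p.ExtOne G) {u : p.K ⟶ p.K} {v : p.P ⟶ p.P} {f : X ⟶ X}
    (hu : u ≫ p.ι = p.ι ≫ v) (hv : v ≫ p.π = p.π ≫ f) (h : G'.δ _ u = G'.δ _ (𝟙 _)) :
    ∃ k : X ⟶ p.P, f + k ≫ p.π = 𝟙 X := by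
  have ep : Epi p.π := p.exact.1.epi_g
  rw [eq_comm, ← sub_eq_zero, ← map_sub, G'.eq_zero_iff] at h
  obtain ⟨s, hs⟩ := h
  -- Correcting 𝟙 - v by s ≫ p.ι, which p.π kills, makes it vanish on p.K, so it descends to the
  -- required map k on X.
  have hz : p.ι ≫ (𝟙 _ - v - s ≫ p.ι) = 0 := by
    rw [Preadditive.comp_sub, ← Category.assoc, hs, Preadditive.comp_sub, ← hu,
      Preadditive.sub_comp, Category.id_comp, Category.comp_id, sub_self]
  refine ⟨p.exact.1.exact.desc _ hz, ?_⟩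
  have hk : p.π ≫ p.exact.1.exact.desc _ hz = _ := p.exact.1.exact.g_desc _ hz
  rw [← cancel_epi p.π, Preadditive.comp_add, ← Category.assoc p.π _ p.π, hk, ← hv]
  simp [Preadditive.sub_comp, p.w]

/-- Objects with isomorphic relative `Ext¹` are stably isomorphic. -/
lemma stablyIso (G' : p.ExtOne G) (H' : q.ExtOne H) (e : G ≅ H) : p.StablyIso q := by
  obtain ⟨u, v, f, hu, hv, h⟩ := G'.exists_of_natTrans H' e.inv
  obtain ⟨u', v', f', hu', hv', h'⟩ := H'.exists_of_natTrans G' e.hom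
  obtain ⟨k, hk⟩ := G'.exists_factor (u := u ≫ u') (v := v ≫ v') (f := f ≫ f')
    (by rw [Category.assoc, hu', reassoc_of% hu])
    (by rw [Category.assoc, hv', reassoc_of% hv]) (by
      have := h _ u'
      rw [← this, ← Category.comp_id u', ← h']
      exact ConcreteCategory.congr_hom (e.hom_inv_id_app _) _)
  obtain ⟨k', hk'⟩ := H'.exists_factor (u := u' ≫ u) (v := v' ≫ v) (f := f' ≫ f)
    (by rw [Category.assoc, hu, reassoc_of% hu'])
    (by rw [Category.assoc, hv, reassoc_of% hv']) (by
      have := h' _ u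
      rw [← this, ← Category.comp_id u, ← h]
      exact ConcreteCategory.congr_hom (e.inv_hom_id_app _) _)
  exact ⟨f, f', k, k', hk, hk'⟩

end Presentation.ExtOne

/-! ### Dimension shift and the comparison of Ext functors with K_F -/

variable (hF : F.EnoughProjectives)

/-- Dimension shift: `Ext^{n+1}_F(X, -)` is the relative `Ext¹` of the `n`-th syzygy. -/
noncomputable def EnoughProjectives.extOne (X : C) (n : ℕ) :
    (hF.presentation (hF.syzygy X n)).ExtOne (hF.extFunctor X (n + 1)) where
  δ Z := (QuotientAddGroup.mk' _).comp
    { toFun := fun a => (⟨(hF.presentation (hF.syzygy X (n + 1))).π ≫ a, by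
        have aux : ∀ {V W X Y Z : C} (f : V ⟶ W) (g : W ⟶ X) (h : X ⟶ Y) (k : Y ⟶ Z),
          g ≫ h = 0 → (f ≫ g) ≫ h ≫ k = 0 := fun f g h k hgh => by
            rw [Category.assoc, reassoc_of% hgh, zero_comp, comp_zero]
        exact aux _ _ _ a (hF.presentation (hF.syzygy X (n + 1))).w⟩ : hF.cocycles X (n + 1) Z)
      map_zero' := Subtype.ext comp_zero
      map_add' := fun a b => Subtype.ext (Preadditive.comp_add _ _ _ _ a b) }
  surjective Z x := by
    obtain ⟨⟨f, hf⟩, rfl⟩ := QuotientAddGroup.mk_surjective x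
    have aux : ∀ {V W X Z : C} (f : V ⟶ W) [Epi f] (g : W ⟶ X) (h : X ⟶ Z),
        (f ≫ g) ≫ h = 0 → g ≫ h = 0 := fun f _ g h e => by
      rw [← cancel_epi f, ← Category.assoc, e, comp_zero]
    have : Epi (hF.presentation (hF.syzygy X (n + 1 + 1))).π :=
      (hF.presentation (hF.syzygy X (n + 1 + 1))).exact.1.epi_g
    have hz := aux (hF.presentation (hF.syzygy X (n + 1 + 1))).π
      (hF.presentation (hF.syzygy X (n + 1))).ι f hf
    have hex := (hF.presentation (hF.syzygy X (n + 1))).exact.1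
    have : Epi (hF.presentation (hF.syzygy X (n + 1))).π := hex.epi_g
    exact ⟨hex.exact.desc f hz, congrArg _ (Subtype.ext (hex.exact.g_desc f hz))⟩
  naturality a g := congrArg _ (Subtype.ext (Category.assoc _ a g))
  eq_zero_iff {Z} a := by
    have : Epi (hF.presentation (hF.syzygy X (n + 1))).π :=
      (hF.presentation (hF.syzygy X (n + 1))).exact.1.epi_g
    have aux : ∀ {V W X : C} (f : V ⟶ W) [Epi f] (g : W ⟶ X) (b : X ⟶ Z) (a : W ⟶ Z),
        (f ≫ g) ≫ b = f ≫ a ↔ g ≫ b = a := fun f _ g b a => by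
      rw [Category.assoc, cancel_epi]
    refine (QuotientAddGroup.eq_zero_iff _).trans (exists_congr fun b => ?_)
    exact aux (hF.presentation (hF.syzygy X (n + 1))).π
      (hF.presentation (hF.syzygy X n)).ι b a

lemma EnoughProjectives.extFunctor_iso_iff [IsKrullSchmidt C] (X Y : C) (n : ℕ) :
    Nonempty (hF.extFunctor X (n + 1) ≅ hF.extFunctor Y (n + 1)) ↔
      F.cls (hF.syzygy X n) = F.cls (hF.syzygy Y n) :=
  ⟨fun ⟨e⟩ => ((hF.extOne X n).stablyIso (hF.extOne Y n) e).projectivelyEquivalent.cls_eq,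
    fun h => (hF.extOne X n).nonempty_iso (hF.extOne Y n)
      ((projectivelyEquivalent_of_cls_eq h).stablyIso _ _)⟩

lemma EnoughProjectives.cls_syzygy (X : C) (n : ℕ) :
    F.cls (hF.syzygy X n) = hF.omega^[n] (F.cls X) := by
  induction n with
  | zero => rfl
  | succ n ih =>
    rw [Function.iterate_succ_apply', ← ih]
    exact (hF.omega_cls (hF.presentation (hF.syzygy X n))).symm

end AdditiveSubbifunctor

/-- On a finitely generated subgroup, the iterates of an endomorphism are eventually injective on
the images of the previous ones. -/
lemma exists_injOn_image_iterate {G : Type*} [AddCommGroup G] (f : G →+ G) (H : AddSubgroup G)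
    (hH : H.FG) : ∃ k, ∀ m, k ≤ m → Set.InjOn f (f^[m] '' (H : Set G)) := by
  have hfg : (AddSubgroup.toIntSubmodule H).FG := by
    rw [Submodule.fg_iff_addSubgroup_fg]
    exact hH
  have : Module.Finite ℤ (AddSubgroup.toIntSubmodule H) := Module.Finite.iff_fg.2 hfg
  let g (n : ℕ) : AddSubgroup.toIntSubmodule H →ₗ[ℤ] G :=
    (f.toIntLinearMap ^ n).comp (AddSubgroup.toIntSubmodule H).subtype
  have hg (n : ℕ) (x : AddSubgroup.toIntSubmodule H) : g n x = f^[n] x.1 := by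
    simp only [g, LinearMap.comp_apply, Module.End.pow_apply]
    rfl
  -- The kernels of f^n on H form an ascending chain in a Noetherian ℤ-module; equality of the m-th
  -- and (m+1)-st says that f is injective on f^m H.
  obtain ⟨k, hk⟩ := monotone_stabilizes_iff_noetherian.2
    (inferInstance : IsNoetherian ℤ (AddSubgroup.toIntSubmodule H))
    ⟨fun n => LinearMap.ker (g n), monotone_nat_of_le_succ fun n x hx => by
      rw [LinearMap.mem_ker, hg] at hx ⊢
      rw [Function.iterate_succ_apply', hx, map_zero]⟩
  refine ⟨k, fun m hm => ?_⟩
  rintro _ ⟨x, hx, rfl⟩ _ ⟨y, hy, rfl⟩ h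
  have hxy : (⟨x - y, H.sub_mem hx hy⟩ : AddSubgroup.toIntSubmodule H) ∈
      LinearMap.ker (g (m + 1)) := by
    rw [LinearMap.mem_ker, hg, iterate_map_sub, Function.iterate_succ_apply',
      Function.iterate_succ_apply', h, sub_self]
  have e : LinearMap.ker (g (m + 1)) = LinearMap.ker (g m) :=
    (hk (m + 1) (by omega)).symm.trans (hk m hm)
  rw [e, LinearMap.mem_ker, hg, iterate_map_sub, sub_eq_zero] at hxy
  exact hxy

/-! ### The subgroup ⟨M⟩ and differences of classes from add(M) -/

namespace AdditiveSubbifunctor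

lemma InAdd.of_summand {C : Type u} [Category.{v} C] [Abelian C] {M X Y Z : C} (h : InAdd M X) (e : IsoClass.mk X = IsoClass.mk Y +
    IsoClass.mk Z) : InAdd M Y := by
  obtain ⟨n, x', hx⟩ := IsoClass.inAdd_iff.1 h
  exact IsoClass.inAdd_iff.2 ⟨n, IsoClass.mk Z + x', by rw [hx, e, add_assoc]⟩

variable {C : Type u} [Category.{v} C] [Abelian C] [HasExt.{w} C]

/-- The homomorphism from isomorphism classes to `K_F`. -/
def clsHom (F : AdditiveSubbifunctor.{w} C) : IsoClass C →+ F.KGroup where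
  toFun := Quotient.lift F.cls fun X Y ⟨e⟩ => by
    have h := cls_biprod (F := F) (e ≪≫ isoBiprodZero (X := Y) (isZero_zero C))
    rw [h, cls_projective (fProjective_of_isZero (isZero_zero C)), add_zero]
  map_zero' := cls_projective (fProjective_of_isZero (isZero_zero C))
  map_add' := by
    rintro ⟨X⟩ ⟨Y⟩
    exact cls_biprod (Iso.refl _)

variable {F : AdditiveSubbifunctor.{w} C}

lemma clsHom_mk (X : C) : F.clsHom (IsoClass.mk X) = F.cls X := rfl

section

variable [IsKrullSchmidt C]

/-- Each indecomposable summand of X is either F-projective, with class zero, or a summand of M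
itself by the exchange property. -/
lemma cls_mem_span {M X : C} (h : InAdd M X) : F.cls X ∈ F.span M := by
  obtain ⟨n, x', hn⟩ := IsoClass.inAdd_iff.1 h
  rw [← clsHom_mk]
  generalize IsoClass.mk X = x at hn
  clear h
  induction x using IsoClass.induction_on generalizing x' with
  | zero => rw [map_zero]; exact zero_mem _
  | indec y hy =>
    obtain ⟨N, rfl⟩ := IsoClass.mk_surjective y
    rw [clsHom_mk]
    by_cases hp : F.FProjective N
    · rw [cls_projective hp]; exact zero_mem _
    · obtain ⟨m', hm'⟩ := hy.summand_of_nsmul hn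
      obtain ⟨N', rfl⟩ := IsoClass.mk_surjective m'
      exact AddSubgroup.subset_closure
        ⟨N, IsoClass.isIndecomposable_mk.1 hy, hp, ⟨N', IsoClass.mk_eq_add.1 hm'⟩, rfl⟩
  | add x y hx hy =>
    rw [map_add]
    exact add_mem (hx (y + x') (by rw [hn]; abel)) (hy (x + x') (by rw [hn]; abel))

lemma span_fg (M : C) : (F.span M).FG := by
  refine (AddSubgroup.fg_iff _).2 ⟨_, rfl, ?_⟩
  refine ((IsoClass.finite_indecomposable_summands (IsoClass.mk M)).image F.clsHom).subset ?_
  rintro _ ⟨N, hN, -, ⟨N', h⟩, rfl⟩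
  exact ⟨IsoClass.mk N, ⟨IsoClass.isIndecomposable_mk.2 hN, IsoClass.mk N',
    IsoClass.mk_eq_add.2 h⟩, rfl⟩

end

lemma exists_of_mem_span {M : C} {z : F.KGroup} (hz : z ∈ F.span M) :
    ∃ X Y : C, InAdd M X ∧ InAdd M Y ∧ z = F.cls X - F.cls Y := by
  suffices h : ∃ (x y : IsoClass C) (n k : ℕ) (x' y' : IsoClass C), n • IsoClass.mk M = x + x' ∧
      k • IsoClass.mk M = y + y' ∧ z = F.clsHom x - F.clsHom y by
    obtain ⟨x, y, n, k, x', y', hx, hy, rfl⟩ := h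
    obtain ⟨X, rfl⟩ := IsoClass.mk_surjective x
    obtain ⟨Y, rfl⟩ := IsoClass.mk_surjective y
    exact ⟨X, Y, IsoClass.inAdd_iff.2 ⟨n, x', hx⟩, IsoClass.inAdd_iff.2 ⟨k, y', hy⟩, rfl⟩
  induction hz using AddSubgroup.closure_induction with
  | mem z hz =>
    obtain ⟨N, -, -, ⟨N', h⟩, rfl⟩ := hz
    exact ⟨IsoClass.mk N, 0, 1, 0, IsoClass.mk N', 0,
      by rw [one_smul]; exact IsoClass.mk_eq_add.2 h, by simp, by rw [map_zero, sub_zero]; rfl⟩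
  | zero => exact ⟨0, 0, 0, 0, 0, 0, by simp, by simp, by simp⟩
  | add z t _ _ hz ht =>
    obtain ⟨x, y, n, k, x', y', hx, hy, rfl⟩ := hz
    obtain ⟨a, b, m, l, a', b', ha, hb, rfl⟩ := ht
    refine ⟨x + a, y + b, n + m, k + l, x' + a', y' + b', ?_, ?_, ?_⟩
    · rw [add_smul, hx, ha]; abel
    · rw [add_smul, hy, hb]; abel
    · rw [map_add, map_add]; abel
  | neg z _ hz =>
    obtain ⟨x, y, n, k, x', y', hx, hy, rfl⟩ := hz
    exact ⟨y, x, k, n, y', x', hy, hx, by rw [neg_sub]⟩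

lemma EnoughProjectives.mem_stableIndices_iff (hF : F.EnoughProjectives) {M : C} {k : ℕ} : k ∈ hF.stableIndices M ↔
    ∀ m, k ≤ m → Set.InjOn hF.omega (hF.omega^[m] '' (F.span M : Set F.KGroup)) := by
  refine forall₂_congr fun m _ => ⟨fun h => h.injOn, fun h => ?_⟩
  rw [Function.iterate_succ', Set.image_comp]
  exact h.bijOn_image

variable [IsKrullSchmidt C] (hF : F.EnoughProjectives)

/-- Elements of `⟨M⟩` are differences of classes of objects of `add M` with no common summand. -/
lemma exists_disjoint_of_mem_span {M : C} {z : F.KGroup} (hz : z ∈ F.span M) :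
    ∃ X Y : C, InAdd M X ∧ InAdd M Y ∧ (∀ Z : C, InAdd X Z → InAdd Y Z → IsZero Z) ∧
      z = F.cls X - F.cls Y := by
  obtain ⟨X, Y, hX, hY, rfl⟩ := exists_of_mem_span hz
  obtain ⟨x, y, t, hx, hy, H⟩ := IsoClass.exists_disjoint (IsoClass.mk X) (IsoClass.mk Y)
  obtain ⟨X', rfl⟩ := IsoClass.mk_surjective x
  obtain ⟨Y', rfl⟩ := IsoClass.mk_surjective y
  obtain ⟨T, rfl⟩ := IsoClass.mk_surjective t
  refine ⟨X', Y', hX.of_summand hx, hY.of_summand hy, fun Z hXZ hYZ => ?_, ?_⟩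
  -- A nonzero common Z would have an indecomposable summand, which exchange places in both X' and
  -- Y'.
  · by_contra hZ
    obtain ⟨n, z', hn, hz'⟩ :=
      IsoClass.exists_indecomposable_summand (mt IsoClass.mk_eq_zero.1 hZ)
    obtain ⟨k, a, ha⟩ := IsoClass.inAdd_iff.1 hXZ
    obtain ⟨l, b, hb⟩ := IsoClass.inAdd_iff.1 hYZ
    rw [hz', add_assoc] at ha hb
    exact H n hn (hn.summand_of_nsmul ha) (hn.summand_of_nsmul hb)
  · rw [← clsHom_mk, ← clsHom_mk, hx, hy, map_add, map_add, clsHom_mk, clsHom_mk]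
    abel

/-! ### Divisions as failures of injectivity of Ω_F -/

namespace EnoughProjectives

lemma stableIndices_nonempty (M : C) : (hF.stableIndices M).Nonempty := by
  obtain ⟨k, hk⟩ := exists_injOn_image_iterate hF.omega (F.span M) (span_fg M)
  exact ⟨k, (hF.mem_stableIndices_iff).2 hk⟩

/-- The shift by one comes from Ext^{d+1}_F being governed by the d-th syzygy. -/
lemma isDivision_iff {M : C} {d : ℕ} {X Y : C} : hF.IsDivision M (d + 1) X Y ↔
    InAdd M X ∧ InAdd M Y ∧ (∀ Z : C, InAdd X Z → InAdd Y Z → IsZero Z) ∧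
      hF.omega^[d] (F.cls X) ≠ hF.omega^[d] (F.cls Y) ∧
      hF.omega^[d + 1] (F.cls X) = hF.omega^[d + 1] (F.cls Y) := by
  rw [← hF.cls_syzygy, ← hF.cls_syzygy, ← hF.cls_syzygy, ← hF.cls_syzygy, Ne,
    ← hF.extFunctor_iso_iff, ← hF.extFunctor_iso_iff]
  exact ⟨fun h => ⟨h.left_mem, h.right_mem, h.disjoint, h.not_iso, h.iso⟩,
    fun ⟨h1, h2, h3, h4, h5⟩ => ⟨Nat.succ_pos d, h1, h2, h3, h4, h5⟩⟩

lemma IsDivision.le_phiDim {M : C} {d : ℕ} {X Y : C} (h : hF.IsDivision M d X Y) :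
    d ≤ hF.phiDim M := by
  obtain ⟨d, rfl⟩ := Nat.exists_eq_add_one.2 h.pos
  obtain ⟨hX, hY, -, hne, heq⟩ := hF.isDivision_iff.1 h
  by_contra! hlt
  have hmem := hF.mem_stableIndices_iff.1 (Nat.sInf_mem (hF.stableIndices_nonempty M)) d
    (Nat.lt_succ_iff.1 hlt)
  rw [Function.iterate_succ_apply', Function.iterate_succ_apply'] at heq
  exact hne (hmem ⟨_, cls_mem_span hX, rfl⟩ ⟨_, cls_mem_span hY, rfl⟩ heq)

lemma exists_isDivision_phiDim {M : C} (h : hF.phiDim M ≠ 0) :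
    ∃ X Y : C, hF.IsDivision M (hF.phiDim M) X Y := by
  obtain ⟨d, hd⟩ := Nat.exists_eq_succ_of_ne_zero h
  have hd' : d ∉ hF.stableIndices M := Nat.notMem_of_lt_sInf (by
    change d < hF.phiDim M
    omega)
  have hmem := hF.mem_stableIndices_iff.1 (Nat.sInf_mem (hF.stableIndices_nonempty M))
  rw [hF.mem_stableIndices_iff] at hd'
  -- With φ-dim equal to d + 1, injectivity holds for every m ≥ d + 1; minimality makes it fail at d
  -- itself.
  have hinj : ¬ Set.InjOn hF.omega (hF.omega^[d] '' (F.span M : Set F.KGroup)) := by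
    refine fun hinj => hd' fun m hm => ?_
    rcases hm.eq_or_lt with rfl | hm
    · exact hinj
    · exact hmem m (by change hF.phiDim M ≤ m; omega)
  simp only [Set.InjOn, not_forall] at hinj
  obtain ⟨_, ⟨x, hx, rfl⟩, _, ⟨y, hy, rfl⟩, heq, hne⟩ := hinj
  obtain ⟨X, Y, hX, hY, hXY, hz⟩ := exists_disjoint_of_mem_span (sub_mem hx hy)
  refine ⟨X, Y, ?_⟩
  rw [hd, Nat.succ_eq_add_one]
  refine hF.isDivision_iff.2 ⟨hX, hY, hXY, ?_, ?_⟩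
  · rwa [← sub_ne_zero, ← iterate_map_sub, ← hz, iterate_map_sub, sub_ne_zero]
  · rwa [← sub_eq_zero, ← iterate_map_sub, ← hz, iterate_map_sub, sub_eq_zero,
      Function.iterate_succ_apply', Function.iterate_succ_apply']

/-- In a Krull-Schmidt category, the relative Igusa-Todorov function is the maximal `d` for which
there is a relative `d`-Division. -/
theorem isGreatest_phiDim (M : C) :
    IsGreatest ({d : ℕ | ∃ X Y : C, hF.IsDivision M d X Y} ∪ {0}) (hF.phiDim M) := by
  constructor
  · by_cases h : hF.phiDim M = 0
    · exact Or.inr h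
    · exact Or.inl (hF.exists_isDivision_phiDim h)
  · rintro d (⟨X, Y, h⟩ | rfl)
    · exact h.le_phiDim
    · exact Nat.zero_le _

end EnoughProjectives

end AdditiveSubbifunctor

/-! ### Finitely generated modules over Artin algebras -/

section

variable {R : Type w} {A : Type u} [CommRing R] [IsArtinianRing R] [Ring A] [Algebra R A]
  [Module.Finite R A]

lemma FGModuleCat.isZero_of_subsingleton [IsNoetherianRing A] {X : FGModuleCat.{u} A}
    [Subsingleton X] : IsZero X := by
  rw [IsZero.iff_id_eq_zero]
  ext x
  exact Subsingleton.elim (α := X) _ _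

/-- Complementary submodules give a direct sum decomposition. -/
lemma FGModuleCat.nonempty_iso_of_isCompl [IsNoetherianRing A] {N : FGModuleCat.{u} A}
    {p q : Submodule A N} (h : IsCompl p q) :
    Nonempty (N ≅ FGModuleCat.of A p ⊞ FGModuleCat.of A q) := by
  let a : N ⟶ FGModuleCat.of A p := FGModuleCat.ofHom (p.projectionOnto q h)
  let b : N ⟶ FGModuleCat.of A q := FGModuleCat.ofHom (q.projectionOnto p h.symm)
  let i : FGModuleCat.of A p ⟶ N := FGModuleCat.ofHom p.subtype
  let j : FGModuleCat.of A q ⟶ N := FGModuleCat.ofHom q.subtype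
  have h1 : i ≫ a = 𝟙 _ := by
    ext x
    exact congrArg Subtype.val (Submodule.projectionOnto_apply_left h x)
  have h2 : i ≫ b = 0 := by
    ext x
    exact congrArg Subtype.val (Submodule.projectionOnto_apply_right h.symm x)
  have h3 : j ≫ a = 0 := by
    ext x
    exact congrArg Subtype.val (Submodule.projectionOnto_apply_right h x)
  have h4 : j ≫ b = 𝟙 _ := by
    ext x
    exact congrArg Subtype.val (Submodule.projectionOnto_apply_left h.symm x)
  have h5 : a ≫ i + b ≫ j = 𝟙 N := by
    ext x
    change (p.projectionOnto q h x : N) + (q.projectionOnto p h.symm x : N) = x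
    rw [Submodule.coe_projectionOnto_apply, Submodule.coe_projectionOnto_apply]
    exact LinearMap.congr_fun (Submodule.projection_add_projection_eq_id h) x
  exact ⟨⟨biprod.lift a b, biprod.desc i j, by rw [biprod.lift_desc, h5],
    by
      apply biprod.hom_ext'
      · apply biprod.hom_ext
        · simp [h1]
        · simp [h2]
      · apply biprod.hom_ext
        · simp [h3]
        · simp [h4]⟩⟩

lemma FGModuleCat.isIso_of_isUnit {N : FGModuleCat.{u} A} (f : N ⟶ N)
    (h : IsUnit (f.hom.hom : Module.End A N)) : IsIso f := by
  obtain ⟨⟨a, b, hab, hba⟩, rfl : a = _⟩ := h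
  exact ⟨FGModuleCat.ofHom b, FGModuleCat.hom_ext hba, FGModuleCat.hom_ext hab⟩

lemma FGModuleCat.eq_bot_of_isZero {N : FGModuleCat.{u} A} {p : Submodule A N}
    [Module.Finite A p] (h : IsZero (FGModuleCat.of A p)) : p = ⊥ := by
  rw [eq_bot_iff]
  intro x hx
  have e := h.eq_of_src (𝟙 _) 0
  exact congrArg Subtype.val (ConcreteCategory.congr_hom e (⟨x, hx⟩ : p))


instance : IsKrullSchmidt (ArtinMod R A) := by
  have : IsArtinianRing A := IsArtinianRing.of_finite R A
  have : IsNoetherianRing A := IsNoetherianRing.of_finite R A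
  change IsKrullSchmidt (FGModuleCat.{u} A)
  refine ⟨⟨fun X => (Module.length A X).toNat, ?_, ?_⟩, ?_⟩
  · intro N X Y e
    have hlen : Module.length A N = Module.length A X + Module.length A Y := by
      let f : X ⟶ N := biprod.inl ≫ e.inv
      let g : N ⟶ Y := e.hom ≫ biprod.snd
      let r : N ⟶ X := e.hom ≫ biprod.fst
      let s : Y ⟶ N := biprod.inr ≫ e.inv
      have h1 : f ≫ r = 𝟙 X := by simp [f, r]
      have h2 : s ≫ g = 𝟙 Y := by simp [s, g]
      have h3 : f ≫ g = 0 := by simp [f, g]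
      have h4 : r ≫ f + g ≫ s = 𝟙 N := by
        have : e.hom ≫ (biprod.fst ≫ biprod.inl + biprod.snd ≫ biprod.inr) ≫ e.inv = 𝟙 N := by
          rw [biprod.total]; simp
        rw [← this]
        simp only [f, g, r, s, Preadditive.comp_add, Preadditive.add_comp, Category.assoc]
      have h1' (x : X) : r.hom.hom (f.hom.hom x) = x := ConcreteCategory.congr_hom h1 x
      have h2' (x : Y) : g.hom.hom (s.hom.hom x) = x := ConcreteCategory.congr_hom h2 x
      have h3' (x : X) : g.hom.hom (f.hom.hom x) = 0 := ConcreteCategory.congr_hom h3 x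
      have h4' (x : N) : f.hom.hom (r.hom.hom x) + s.hom.hom (g.hom.hom x) = x :=
        ConcreteCategory.congr_hom h4 x
      refine Module.length_eq_add_of_exact f.hom.hom g.hom.hom
        (Function.LeftInverse.injective h1') (Function.RightInverse.surjective h2') ?_
      intro x
      refine ⟨fun hx => ⟨r.hom.hom x, ?_⟩, ?_⟩
      · have := h4' x
        rw [hx, map_zero, add_zero] at this
        exact this
      · rintro ⟨y, rfl⟩
        exact h3' y
    change (Module.length A N).toNat = (Module.length A X).toNat + (Module.length A Y).toNat
    rw [hlen, ENat.toNat_add Module.length_ne_top Module.length_ne_top]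
  · intro X h
    have h' : Module.length A X = 0 :=
      (ENat.toNat_eq_zero.1 h).resolve_right Module.length_ne_top
    have := Module.length_eq_zero_iff.1 h'
    exact FGModuleCat.isZero_of_subsingleton
  · intro N hN f
    let φ : Module.End A N := f.hom.hom
    -- Fitting's lemma: N is the direct sum of the kernel and range of φ^n. If the kernel vanishes,
    -- φ^n is a unit, and n ≠ 0 makes φ one; if the range vanishes, φ is nilpotent and 1 - φ is a
    -- unit.
    obtain ⟨n, hn, hn0⟩ :=
      (φ.eventually_isCompl_ker_pow_range_pow.and (Filter.eventually_ne_atTop 0)).exists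
    obtain ⟨e⟩ := FGModuleCat.nonempty_iso_of_isCompl hn
    rcases hN.2 _ _ e with h | h
    · have hker := FGModuleCat.eq_bot_of_isZero h
      have hu : IsUnit (φ ^ n) := by
        rw [Module.End.isUnit_iff]
        refine ⟨LinearMap.ker_eq_bot.1 hker, LinearMap.range_eq_top.1 ?_⟩
        have := hn.sup_eq_top
        rwa [hker, bot_sup_eq] at this
      exact Or.inl (FGModuleCat.isIso_of_isUnit f ((isUnit_pow_iff hn0).1 hu))
    · have hnil : IsNilpotent φ := ⟨n, LinearMap.range_eq_bot.1 (FGModuleCat.eq_bot_of_isZero h)⟩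
      exact Or.inr (FGModuleCat.isIso_of_isUnit _ hnil.isUnit_one_sub)

end

end RelativeHomology
open RelativeHomology in
theorem theorem4p8 {R : Type w} {A : Type u} [CommRing R] [IsArtinianRing R] [Ring A]
    [Algebra R A] [Module.Finite R A] (F : AdditiveSubbifunctor (ArtinMod R A))
    (hF : F.EnoughProjectives) (M : ArtinMod R A) :
    (hF.stableIndices M).Nonempty ∧
      IsGreatest ({d : ℕ | ∃ X Y : ArtinMod R A, hF.IsDivision M d X Y} ∪ {0}) (hF.phiDim M) :=
  ⟨hF.stableIndices_nonempty M, hF.isGreatest_phiDim M⟩
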